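/- Let $\mathbb{H}^n$ be the unit ball $B\subset\mathbb{R}^n$ with the metric $\frac{4}{(1-|x|^2)^2}\delta_{ij}$, let $d(\cdot,\cdot)$ be its distance and $\Delta$ its Laplace–Beltrami operator, and let $\partial_\infty\mathbb{H}^n=\partial B$. For $\Omega\subset\mathbb{H}^n$ put $\partial_\infty\Omega=\partial\Omega\cap\partial B$. Let $\lambda_1=\lambda_1(\mathbb{H}^n)=(n-1)^2/4$; a $\lambda_1$-harmonic function on $\mathbb{H}^n$ is a function $u\not\equiv 0$ of class $C^2$ with $-\Delta u=\lambda_1 u$. For $o\in\mathbb{H}^n$ let $f_o$ be the map from $\partial_\infty\mathbb{H}^n$ to the unit sphere of $T_o\mathbb{H}^n\cong\mathbb{R}^n$ that sends $\xi$ to the initial unit vector of the geodesic ray from $o$ to $\xi$. Let $H^s$ be the $s$-dimensional Hausdorff measure on $\mathbb{R}^n$. Let $\frac{n-1}{2}<s<n-1$. A set $X\subset\partial_\infty\mathbb{H}^n$ is called truly $s$-dimensional, with base point $o$ and constant $K>0$, if $\Lambda=f_o(X)$ has Hausdorff dimension $s$, $H^s(\Lambda)<\infty$, and for every $p_0\in\Lambda$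 $$\liminf_{r\to0^+}\frac{H^s(\Lambda\cap B_r(p_0))}{r^s}>0\qquad\text{and}\qquad H^s(\Lambda\cap B_r(p_0))\le K r^s\ \text{ for all } r>0 .$$ **Theorem.** For all $n$, $s$ with $\frac{n-1}{2}<s<n-1$ and all $K>0$ there is a constant $M_0>0$, depending only on $n$, $s$ and $K$, with the following property. If $X\subset\partial_\infty\mathbb{H}^n$ is truly $s$-dimensional with base point $o$ and constant $K$, then there is a bounded $\lambda_1$-harmonic function $u$ on $\mathbb{H}^n$ that is positive on some open set $\Omega\subset\mathbb{H}^n$ with $\partial_\infty\Omega=\overline{X}$, and that satisfies $$|u(p)|\le M_0\,(d+1)\,e^{-\left(s-\frac{n-1}{2}\right)d},\qquad d=d(p,o),$$ for all $p\in\mathbb{H}^n$. Moreover $u$ can be taken to be $$u(p)=\int_{\Lambda}u_z(\varphi_o(p))\,dH^s(z),\qquad u_z(x)=\left[\frac{1-|x|^2}{|z-x|^2}\right]^{\frac{n-1}{2}}\ln\left[\frac{1-|x|^2}{|z-x|^2}\right],$$ where the integral converges absolutely for every $p$, and $\varphi_o$ is the hyperbolic translation $x\mapsto(-o)\oplus x$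 (Möbius addition), that is, the isometry of $\mathbb{H}^n$ with $\varphi_o(o)=0$ whose differential at $o$ is a positive multiple of the identity of $\mathbb{R}^n$. -/

import Mathlib

open MeasureTheory Filter Topology Metric Set

noncomputable section

namespace HypBall

/-- Euclidean space `ℝⁿ`. Hyperbolic space `ℍⁿ` is the open unit ball `ball 0 1` in it (Poincaré
ball model), its asymptotic boundary `∂∞ℍⁿ` is the unit sphere `sphere 0 1`, and the cone topology
on `ℍⁿ ∪ ∂∞ℍⁿ` is the Euclidean topology of the closed unit ball. -/
abbrev E (n : ℕ) := EuclideanSpace ℝ (Fin n)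

/-- The conformal factor `ρ` of the hyperbolic metric `g = ρ² ∑ dxᵢ²`, that is
`g_{ij} = 4 / (1 - |x|²)² δ_{ij}`. -/
def conf {n : ℕ} (x : E n) : ℝ := 2 / (1 - ‖x‖ ^ 2)

/-- The hyperbolic distance of two points of the unit ball:
`sinh² (d / 2) = |x - y|² / ((1 - |x|²) (1 - |y|²))`. -/
def hdist {n : ℕ} (x y : E n) : ℝ :=
  2 * Real.arsinh (‖x - y‖ / √((1 - ‖x‖ ^ 2) * (1 - ‖y‖ ^ 2)))

/-- The partial derivative `∂ᵢ f`. -/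
def partialDeriv {n : ℕ} (i : Fin n) (f : E n → ℝ) (x : E n) : ℝ :=
  fderiv ℝ f x (EuclideanSpace.single i 1)

/-- The Laplace–Beltrami operator `(det g)^{-1/2} ∑ ∂ᵢ ((det g)^{1/2} g^{ij} ∂ⱼ u)` of the
hyperbolic metric, where `(det g)^{1/2} = ρⁿ` and `g^{ij} = ρ⁻² δ_{ij}`. -/
def hypLaplacian {n : ℕ} (u : E n → ℝ) (x : E n) : ℝ :=
  (conf x ^ n)⁻¹ * ∑ i : Fin n,
    partialDeriv i (fun y => conf y ^ n * (conf y ^ 2)⁻¹ * partialDeriv i u y) x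

/-- `u` is `lam`-harmonic on `ℍⁿ`: a nontrivial `C²` solution of `-Δu = lam u`. Only the values
of `u` on the unit ball matter. -/
def IsLambdaHarmonic {n : ℕ} (lam : ℝ) (u : E n → ℝ) : Prop :=
  ContDiffOn ℝ 2 u (ball 0 1) ∧ (∃ x ∈ ball (0 : E n) 1, u x ≠ 0) ∧
    ∀ x ∈ ball (0 : E n) 1, -hypLaplacian u x = lam * u x

/-- The first eigenvalue `λ₁(ℍⁿ) = (n - 1)² / 4`. -/
def lambdaOne (n : ℕ) : ℝ := ((n : ℝ) - 1) ^ 2 / 4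

/-- The asymptotic boundary `∂∞Ω = ∂Ω ∩ ∂B` of a set `Ω ⊆ ℍⁿ`. -/
def asymptoticBoundary {n : ℕ} (Ω : Set (E n)) : Set (E n) := frontier Ω ∩ sphere 0 1

/-- The hyperbolic translation `x ↦ (-o) ⊕ x` (Möbius addition) of the closed unit ball. It is an
isometry of `ℍⁿ` that sends `o` to the centre `0`, and its differential at `o` is a positive
multiple of the identity. Thus `translate o x` is the coordinate of `x` in the ball model that is
centred at `o`. -/
def translate {n : ℕ} (o x : E n) : E n :=
  (1 - 2 * inner ℝ o x + ‖o‖ ^ 2 * ‖x‖ ^ 2)⁻¹ •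
    ((1 - ‖o‖ ^ 2) • x - (1 - 2 * inner ℝ o x + ‖x‖ ^ 2) • o)

/-- The identification `f_o` of `∂∞ℍⁿ` with the unit sphere of `T_oℍⁿ`, which sends `ξ` to the
initial unit vector of the geodesic ray from `o` to `ξ` (the theorem
`exists_geodesicRay_identification` below). A tangent vector at `o` is written in the `g`-orthonormal
basis `(conf o)⁻¹ eᵢ`, so that `T_oℍⁿ` is isometric to `ℝⁿ`. -/
def identification {n : ℕ} (o ξ : E n) : E n := translate o ξ

/-- A unit speed geodesic ray in `ℍⁿ` that starts at `o`. -/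
structure IsGeodesicRayFrom {n : ℕ} (o : E n) (γ : ℝ → E n) : Prop where
  start : γ 0 = o
  mem_ball : ∀ t, 0 ≤ t → γ t ∈ ball (0 : E n) 1
  isometry : ∀ s t, 0 ≤ s → 0 ≤ t → hdist (γ s) (γ t) = |s - t|

lemma denom_pos {n : ℕ} {o x : E n} (ho : ‖o‖ < 1) (hx : ‖x‖ ≤ 1) :
    0 < 1 - 2 * inner ℝ o x + ‖o‖ ^ 2 * ‖x‖ ^ 2 := by
  have h := real_inner_le_norm o x
  have h2 : ‖o‖ * ‖x‖ < 1 := by nlinarith [norm_nonneg o, norm_nonneg x]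
  nlinarith [mul_pos (sub_pos.2 h2) (sub_pos.2 h2)]

lemma translate_norm_sq {n : ℕ} {o x : E n} (ho : ‖o‖ < 1) (hx : ‖x‖ ≤ 1) :
    1 - ‖translate o x‖ ^ 2 = (1 - ‖o‖ ^ 2) * (1 - ‖x‖ ^ 2) /
      (1 - 2 * inner ℝ o x + ‖o‖ ^ 2 * ‖x‖ ^ 2) := by
  have hD := denom_pos ho hx
  rw [translate, norm_smul, mul_pow, norm_sub_sq_real, norm_smul, norm_smul, inner_smul_left,
    inner_smul_right, real_inner_comm o x]
  simp only [mul_pow, Real.norm_eq_abs, sq_abs, conj_trivial]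
  generalize inner ℝ o x = a at *
  field_simp
  ring

lemma translate_sub_norm_sq {n : ℕ} {o x y : E n} (ho : ‖o‖ < 1) (hx : ‖x‖ ≤ 1) (hy : ‖y‖ ≤ 1) :
    ‖translate o x - translate o y‖ ^ 2 = (1 - ‖o‖ ^ 2) ^ 2 * ‖x - y‖ ^ 2 /
      ((1 - 2 * inner ℝ o x + ‖o‖ ^ 2 * ‖x‖ ^ 2) *
        (1 - 2 * inner ℝ o y + ‖o‖ ^ 2 * ‖y‖ ^ 2)) := by
  have hD := denom_pos ho hx
  have hD' := denom_pos ho hy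
  have h1 := translate_norm_sq ho hx
  have h2 := translate_norm_sq ho hy
  have h3 : inner ℝ (translate o x) (translate o y) =
      ((1 - ‖o‖ ^ 2) ^ 2 * inner ℝ x y
        - (1 - ‖o‖ ^ 2) * (1 - 2 * inner ℝ o y + ‖y‖ ^ 2) * inner ℝ o x
        - (1 - ‖o‖ ^ 2) * (1 - 2 * inner ℝ o x + ‖x‖ ^ 2) * inner ℝ o y
        + (1 - 2 * inner ℝ o x + ‖x‖ ^ 2) * (1 - 2 * inner ℝ o y + ‖y‖ ^ 2) * ‖o‖ ^ 2) /
      ((1 - 2 * inner ℝ o x + ‖o‖ ^ 2 * ‖x‖ ^ 2) *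
        (1 - 2 * inner ℝ o y + ‖o‖ ^ 2 * ‖y‖ ^ 2)) := by
    simp only [translate, inner_smul_left, inner_smul_right, inner_sub_left, inner_sub_right,
      conj_trivial, real_inner_comm o x, real_inner_self_eq_norm_sq]
    field_simp
    ring
  rw [norm_sub_sq_real, norm_sub_sq_real, h3,
    show ‖translate o x‖ ^ 2 = 1 - (1 - ‖translate o x‖ ^ 2) by ring,
    show ‖translate o y‖ ^ 2 = 1 - (1 - ‖translate o y‖ ^ 2) by ring, h1, h2]
  generalize inner ℝ o x = a at *
  generalize inner ℝ o y = b at *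
  generalize inner ℝ x y = c at *
  field_simp
  ring

lemma translate_norm_lt_one {n : ℕ} {o x : E n} (ho : ‖o‖ < 1) (hx : ‖x‖ < 1) :
    ‖translate o x‖ < 1 := by
  have h := translate_norm_sq ho hx.le
  have hD := denom_pos ho hx.le
  have : 0 < 1 - ‖translate o x‖ ^ 2 := by
    rw [h]
    have : 0 < 1 - ‖o‖ ^ 2 := by nlinarith [norm_nonneg o]
    have : 0 < 1 - ‖x‖ ^ 2 := by nlinarith [norm_nonneg x]
    positivity
  nlinarith [norm_nonneg (translate o x)]

/-- Translations are isometries of `ℍⁿ`. -/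
theorem hdist_translate {n : ℕ} {o x y : E n} (ho : ‖o‖ < 1) (hx : ‖x‖ < 1) (hy : ‖y‖ < 1) :
    hdist (translate o x) (translate o y) = hdist x y := by
  have hD := denom_pos ho hx.le
  have hD' := denom_pos ho hy.le
  have ho' : 0 < 1 - ‖o‖ ^ 2 := by nlinarith [norm_nonneg o]
  have hx' : 0 < 1 - ‖x‖ ^ 2 := by nlinarith [norm_nonneg x]
  have hy' : 0 < 1 - ‖y‖ ^ 2 := by nlinarith [norm_nonneg y]
  have key : ∀ a b : E n, ‖a - b‖ / √((1 - ‖a‖ ^ 2) * (1 - ‖b‖ ^ 2)) =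
      √(‖a - b‖ ^ 2 / ((1 - ‖a‖ ^ 2) * (1 - ‖b‖ ^ 2))) := by
    intro a b
    rw [Real.sqrt_div (by positivity), Real.sqrt_sq (norm_nonneg _)]
  rw [hdist, hdist, key, key, translate_sub_norm_sq ho hx.le hy.le, translate_norm_sq ho hx.le,
    translate_norm_sq ho hy.le]
  congr 3
  generalize inner ℝ o x = a at *
  generalize inner ℝ o y = b at *
  field_simp

lemma translate_neg_translate {n : ℕ} {o ξ : E n} (ho : ‖o‖ < 1) (hξ : ‖ξ‖ = 1) :
    translate (-o) (translate o ξ) = ξ := by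
  have hD := denom_pos ho hξ.le
  have ho' : 0 < 1 - ‖o‖ ^ 2 := by nlinarith [norm_nonneg o]
  have hN := translate_norm_sq ho hξ.le
  have hN' : ‖translate o ξ‖ ^ 2 = 1 := by
    rw [hξ] at hN; simp at hN; linarith
  have hI : inner ℝ o (translate o ξ) = ((1 - ‖o‖ ^ 2) * inner ℝ o ξ
      - (1 - 2 * inner ℝ o ξ + 1) * ‖o‖ ^ 2) / (1 - 2 * inner ℝ o ξ + ‖o‖ ^ 2) := by
    simp only [translate, inner_smul_right, inner_sub_right, real_inner_self_eq_norm_sq, hξ]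
    field_simp
  rw [hξ] at hD
  have hden : 1 + 2 * inner ℝ o (translate o ξ) + ‖o‖ ^ 2 =
      (1 - ‖o‖ ^ 2) ^ 2 / (1 - 2 * inner ℝ o ξ + ‖o‖ ^ 2) := by
    rw [hI]
    generalize inner ℝ o ξ = a at *
    have : 1 - 2 * a + ‖o‖ ^ 2 ≠ 0 := by nlinarith
    field_simp
    ring
  have hden2 : 1 + 2 * inner ℝ o (translate o ξ) + 1 =
      (1 - ‖o‖ ^ 2) * (2 - 2 * inner ℝ o ξ) / (1 - 2 * inner ℝ o ξ + ‖o‖ ^ 2) := by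
    rw [hI]
    generalize inner ℝ o ξ = a at *
    have : 1 - 2 * a + ‖o‖ ^ 2 ≠ 0 := by nlinarith
    field_simp
    ring
  have e1 : translate (-o) (translate o ξ) =
      (1 + 2 * inner ℝ o (translate o ξ) + ‖o‖ ^ 2)⁻¹ •
        ((1 - ‖o‖ ^ 2) • translate o ξ + (1 + 2 * inner ℝ o (translate o ξ) + 1) • o) := by
    conv_lhs => rw [translate]
    simp only [inner_neg_left, norm_neg, hN', smul_neg, sub_neg_eq_add, mul_neg, mul_one]
  rw [e1, hden, hden2, translate, hξ]
  generalize inner ℝ o ξ = a at *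
  have : 1 - 2 * a + ‖o‖ ^ 2 ≠ 0 := by nlinarith
  simp only [one_pow, mul_one]
  match_scalars
  · field_simp
  · field_simp
    ring

lemma hdist_radial {n : ℕ} {v : E n} (hv : ‖v‖ = 1) (s t : ℝ) :
    hdist (Real.tanh (s / 2) • v) (Real.tanh (t / 2) • v) = |s - t| := by
  have hs := Real.cosh_pos (s / 2)
  have ht := Real.cosh_pos (t / 2)
  have h : ∀ r : ℝ, 1 - ‖Real.tanh r • v‖ ^ 2 = (Real.cosh r ^ 2)⁻¹ := by
    intro r
    have := Real.cosh_pos r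
    rw [norm_smul, hv, mul_one, Real.norm_eq_abs, sq_abs, Real.tanh_eq_sinh_div_cosh]
    field_simp
    linarith [Real.cosh_sq r]
  have h2 : √((Real.cosh (s / 2) ^ 2)⁻¹ * (Real.cosh (t / 2) ^ 2)⁻¹) =
      (Real.cosh (s / 2) * Real.cosh (t / 2))⁻¹ := by
    rw [← mul_inv, ← mul_pow, ← inv_pow, Real.sqrt_sq (by positivity)]
  have h3 : ‖Real.tanh (s / 2) • v - Real.tanh (t / 2) • v‖ / 
      (Real.cosh (s / 2) * Real.cosh (t / 2))⁻¹ = Real.sinh (|s - t| / 2) := by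
    rw [← sub_smul, norm_smul, hv, mul_one, Real.norm_eq_abs, div_inv_eq_mul,
      ← abs_of_pos (mul_pos hs ht), ← abs_mul]
    have : (Real.tanh (s / 2) - Real.tanh (t / 2)) * (Real.cosh (s / 2) * Real.cosh (t / 2))
        = Real.sinh ((s - t) / 2) := by
      rw [sub_div, Real.sinh_sub, Real.tanh_eq_sinh_div_cosh, Real.tanh_eq_sinh_div_cosh]
      field_simp
    rw [this, Real.abs_sinh, abs_div, abs_two]
  rw [hdist, h, h, h2, h3, Real.arsinh_sinh]
  ring

/-- For `o ∈ ℍⁿ` and `ξ ∈ ∂∞ℍⁿ`, `identification o ξ` is a unit vector, and it is the initial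
velocity, in the `g`-orthonormal basis `(conf o)⁻¹ eᵢ` of `T_oℍⁿ`, of a unit speed geodesic ray
from `o` to `ξ`. -/
theorem exists_geodesicRay_identification {n : ℕ} {o ξ : E n} (ho : ‖o‖ < 1) (hξ : ‖ξ‖ = 1) :
    ‖identification o ξ‖ = 1 ∧ ∃ γ : ℝ → E n, IsGeodesicRayFrom o γ ∧
      Tendsto γ atTop (𝓝 ξ) ∧ HasDerivAt γ ((conf o)⁻¹ • identification o ξ) 0 := by
  have ho' : 0 < 1 - ‖o‖ ^ 2 := by nlinarith [norm_nonneg o]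
  have hno : ‖-o‖ < 1 := by rwa [norm_neg]
  have hv : ‖identification o ξ‖ = 1 := by
    have hN := translate_norm_sq ho hξ.le
    rw [hξ] at hN
    simp only [one_pow, sub_self, mul_zero, zero_div] at hN
    have : ‖translate o ξ‖ ^ 2 = 1 := by linarith
    exact (pow_eq_one_iff_of_nonneg (norm_nonneg _) two_ne_zero).1 this
  have hlt : ∀ t : ℝ, ‖Real.tanh (t / 2) • identification o ξ‖ < 1 := by
    intro t
    rw [norm_smul, hv, mul_one, Real.norm_eq_abs]
    exact Real.abs_tanh_lt_one _
  refine ⟨hv, fun t => translate (-o) (Real.tanh (t / 2) • identification o ξ),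
    ⟨?_, ?_, ?_⟩, ?_, ?_⟩
  · simp [translate]
  · intro t _
    rw [mem_ball_zero_iff]
    exact translate_norm_lt_one hno (hlt t)
  · intro s t _ _
    rw [hdist_translate hno (hlt s) (hlt t), hdist_radial hv]
  · have hcont : ContinuousAt (translate (-o)) (identification o ξ) := by
      unfold translate
      have := (denom_pos hno hv.le).ne'
      fun_prop (disch := assumption)
    have hlim : Tendsto (fun t : ℝ => Real.tanh (t / 2) • identification o ξ) atTop
        (𝓝 (identification o ξ)) := by
      have : Tendsto (fun t : ℝ => Real.tanh (t / 2)) atTop (𝓝 1) :=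
        by
        have h : ∀ x : ℝ, Real.tanh (x / 2) = 1 - 2 * (Real.exp x + 1)⁻¹ := by
          intro x
          have e : Real.exp x = Real.exp (x / 2) * Real.exp (x / 2) := by
            rw [← Real.exp_add]; ring_nf
          have := Real.exp_pos (x / 2)
          rw [Real.tanh_eq_sinh_div_cosh, Real.sinh_eq, Real.cosh_eq, Real.exp_neg, e]
          field_simp
          ring
        have h2 : Tendsto (fun x : ℝ => (Real.exp x + 1)⁻¹) atTop (𝓝 0) :=
          (tendsto_atTop_add_const_right _ _ Real.tendsto_exp_atTop).inv_tendsto_atTop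
        simp_rw [h]
        simpa using (h2.const_mul 2).const_sub 1
      simpa using this.smul_const (identification o ξ)
    have := hcont.tendsto.comp hlim
    rwa [show translate (-o) (identification o ξ) = ξ from translate_neg_translate ho hξ] at this
  · set v := identification o ξ
    have hτ : HasDerivAt (fun t : ℝ => Real.tanh (t / 2)) (1 / 2) 0 := by
      have h1 : HasDerivAt (fun t : ℝ => t / 2) (1 / 2) 0 := (hasDerivAt_id _).div_const 2
      have h2 := (h1.sinh).div h1.cosh (by simp)
      refine (h2.congr_deriv (by simp)).congr_of_eventuallyEq (Eventually.of_forall fun t => ?_)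
      simp [Real.tanh_eq_sinh_div_cosh]
    have h0 : Real.tanh ((0 : ℝ) / 2) = 0 := by simp
    have hG : HasDerivAt (fun τ : ℝ => (1 + 2 * (τ * inner ℝ o v) + ‖o‖ ^ 2 * τ ^ 2)⁻¹ •
        (((1 - ‖o‖ ^ 2) * τ) • v + (1 + 2 * (τ * inner ℝ o v) + τ ^ 2) • o))
        ((1 - ‖o‖ ^ 2) • v) (Real.tanh ((0 : ℝ) / 2)) := by
      rw [h0]
      have d1 : HasDerivAt (fun τ : ℝ => τ * inner ℝ o v) (inner ℝ o v) 0 := by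
        simpa using (hasDerivAt_id (0 : ℝ)).mul_const (inner ℝ o v)
      have d2 : HasDerivAt (fun τ : ℝ => τ ^ 2) 0 0 := by
        simpa using hasDerivAt_pow 2 (0 : ℝ)
      have d3 := ((d1.const_mul 2).const_add 1).add (d2.const_mul (‖o‖ ^ 2))
      have d4 := (((hasDerivAt_id (0 : ℝ)).const_mul (1 - ‖o‖ ^ 2)).smul_const v).add
        ((((d1.const_mul 2).const_add 1).add d2).smul_const o)
      have d5 := (d3.inv (by simp)).smul d4
      refine d5.congr_deriv ?_
      simp
    refine ((hG.scomp (0 : ℝ) hτ).congr_deriv ?_).congr_of_eventuallyEq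
      (Eventually.of_forall fun t => ?_)
    · simp only [conf, inv_div, smul_smul]
      congr 1
      ring
    · simp only [Function.comp, translate, inner_neg_left, inner_smul_right, norm_neg, norm_smul,
        show ‖v‖ = 1 from hv, mul_one, Real.norm_eq_abs, sq_abs, smul_neg, sub_neg_eq_add,
        mul_neg, smul_smul]

/-- `X ⊆ ∂∞ℍⁿ` is truly `s`-dimensional with respect to the identification `f_o` and the
constant `K`: `f_o(X)` has Hausdorff dimension `s`, finite `s`-dimensional Hausdorff measure `H^s`,
positive lower `s`-density at each of its points, and `H^s(f_o(X) ∩ B_r(p)) ≤ K r^s` for all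
`p ∈ f_o(X)` and `r > 0`. -/
structure IsTrulyDimAt {n : ℕ} (s : ℝ) (o : E n) (K : ℝ) (X : Set (E n)) : Prop where
  dim_eq : dimH (identification o '' X) = ENNReal.ofReal s
  measure_lt_top : μH[s] (identification o '' X) < ⊤
  lower_density : ∀ p ∈ identification o '' X,
    0 < liminf (fun r : ℝ => μH[s] (identification o '' X ∩ ball p r) / ENNReal.ofReal (r ^ s))
      (𝓝[>] 0)
  upper_density : ∀ p ∈ identification o '' X, ∀ r : ℝ, 0 < r →
    μH[s] (identification o '' X ∩ ball p r) ≤ ENNReal.ofReal (K * r ^ s)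

/-- The signed hyperbolic distance `log ((1 - |x|²) / |z - x|²)` of `x ∈ ℍⁿ` to the horosphere
through the centre `0` with centre `z ∈ ∂∞ℍⁿ`, positive inside the horoball. -/
def horoDist {n : ℕ} (z x : E n) : ℝ := Real.log ((1 - ‖x‖ ^ 2) / ‖z - x‖ ^ 2)

/-- The horospherical function
`u_z(x) = ((1 - |x|²) / |z - x|²)^((n-1)/2) * log ((1 - |x|²) / |z - x|²)`. -/
def horoFun {n : ℕ} (z x : E n) : ℝ :=
  ((1 - ‖x‖ ^ 2) / ‖z - x‖ ^ 2) ^ (((n : ℝ) - 1) / 2) * horoDist z x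

end HypBall

end

noncomputable section

namespace HypBall

/-! ### Differentiation under an integral over a compact parameter set. -/

section ParametricIntegral

variable {Z F G : Type*} [NormedAddCommGroup Z] [NormedAddCommGroup F] [NormedAddCommGroup G]

/-! Write `a = (n-1)/2`, let `P` be the Poisson ratio and `ν` the restriction of `H^s` to `Λ`.

The function `b = log P` satisfies `|∇b| = 1` and `Δb = -2a` in the hyperbolic metric, so `P^a log P
= e^{ab} b` is an eigenfunction for `a² = λ₁` (`hypLaplacian_exp_mul_busemann`). Moving the base
point multiplies `P` by a factor depending on the boundary point alone, which shifts `b` by a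
constant and preserves these identities. The kernel is smooth on sphere times ball and the sphere is
compact, so the equation passes under the integral (`hypLaplacian_integral`).

Decay: `|log P| ≤ d + 2`, and summing the upper density bound over dyadic shells gives `∫ P^a dν ≤ C
(1-|x|)^{s-a}`; the series converges because `s < 2a`. Since `1 - |x| ≤ 2e^{-d}` and `s > a`, this
is the stated bound (`abs_integral_horoFun_le`), and boundedness follows from it.

Positivity: if `x` tends to `p ∈ Λ` nontangentially at depth `δ = 1 - |x|`, the ball `B_δ(p)`
contributes at least a multiple of `δ^{s-a}`, by lower density. The negative part is at most `ε⁻¹ ∫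
P^{a-ε} dν`, of order `δ^{s-a+ε}`, hence negligible (`eventually_integral_horoFun_pos`). How small
`δ` must be depends on `p`, so `Ω` is the set where `u > 0` inside nontangential regions at points
of `X`, rather than a union of truncated cones of one size. -/

theorem integrable_of_continuousOn_compact [MeasurableSpace Z] [BorelSpace Z] {μ : Measure Z}
    [IsFiniteMeasure μ] {K : Set Z} (hK : IsCompact K) (hμ : ∀ᵐ z ∂μ, z ∈ K)
    {f : Z → G} (hf : ContinuousOn f K) : Integrable f μ := by
  rw [← Measure.restrict_eq_self_of_ae_mem hμ]
  exact hf.integrableOn_compact hK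

variable [NormedSpace ℝ Z] [NormedSpace ℝ F] [NormedSpace ℝ G]

/-- The derivative with respect to the second variable. -/
def fderivSnd (f : Z × F → G) (q : Z × F) : F →L[ℝ] G :=
  (fderiv ℝ f q).comp (ContinuousLinearMap.inr ℝ Z F)

theorem hasFDerivAt_fderivSnd {f : Z × F → G} {z : Z} {x : F} (hf : DifferentiableAt ℝ f (z, x)) :
    HasFDerivAt (fun y => f (z, y)) (fderivSnd f (z, x)) x :=
  hf.hasFDerivAt.comp x (hasFDerivAt_prodMk_right z x)

theorem contDiffAt_fderivSnd {f : Z × F → G} {q : Z × F} {k : ℕ}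
    (hf : ContDiffAt ℝ (k + 1) f q) : ContDiffAt ℝ k (fderivSnd f) q :=
  (hf.fderiv_right le_rfl).clm_comp contDiffAt_const

variable [MeasurableSpace Z] [BorelSpace Z] [FiniteDimensional ℝ F] {μ : Measure Z}
  [IsFiniteMeasure μ] {K : Set Z} {U : Set F}

/-- Joint `C¹` regularity bounds the derivative on `K` times a small closed ball, and over a finite
measure that constant is an integrable majorant. The target `G` is arbitrary so that the lemma
applies again to `fderivSnd f`. -/
theorem hasFDerivAt_integral_snd (hK : IsCompact K) (hμ : ∀ᵐ z ∂μ, z ∈ K)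
    (hU : IsOpen U) {f : Z × F → G} (hf : ∀ z ∈ K, ∀ x ∈ U, ContDiffAt ℝ 1 f (z, x))
    {x : F} (hx : x ∈ U) :
    HasFDerivAt (fun y => ∫ z, f (z, y) ∂μ) (∫ z, fderivSnd f (z, x) ∂μ) x := by
  have hf' : ∀ z ∈ K, ∀ y ∈ U, ContinuousAt (fderivSnd f) (z, y) := fun z hz y hy =>
    (contDiffAt_fderivSnd (k := 0) (by simpa using hf z hz y hy)).continuousAt
  have hint : ∀ y ∈ U, Integrable (fun z => f (z, y)) μ := fun y hy =>
    integrable_of_continuousOn_compact hK hμ fun z hz =>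
      ((hf z hz y hy).continuousAt.comp
        (f := fun z => (z, y)) (by fun_prop)).continuousWithinAt
  have hint' : Integrable (fun z => fderivSnd f (z, x)) μ :=
    integrable_of_continuousOn_compact hK hμ fun z hz =>
      ((hf' z hz x hx).comp (f := fun z => (z, x)) (by fun_prop)).continuousWithinAt
  obtain ⟨r, hr, hrU⟩ := nhds_basis_closedBall.mem_iff.1 (hU.mem_nhds hx)
  obtain ⟨C, hC⟩ := (hK.prod (isCompact_closedBall x r)).exists_bound_of_continuousOn
    (f := fderivSnd f) fun q hq => (hf' q.1 hq.1 q.2 (hrU hq.2)).continuousWithinAt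
  refine hasFDerivAt_integral_of_dominated_of_fderiv_le
    (s := ball x r) (bound := fun _ => C) (ball_mem_nhds x hr)
    (F' := fun y z => fderivSnd f (z, y))
    ?_ (hint x hx) hint'.aestronglyMeasurable ?_ (integrable_const C) ?_
  · filter_upwards [hU.mem_nhds hx] with y hy using (hint y hy).aestronglyMeasurable
  · filter_upwards [hμ] with z hz y hy using hC (z, y) ⟨hz, ball_subset_closedBall hy⟩
  · filter_upwards [hμ] with z hz y hy
    exact hasFDerivAt_fderivSnd
      ((hf z hz y (hrU (ball_subset_closedBall hy))).differentiableAt one_ne_zero)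

omit [NormedSpace ℝ Z] in
theorem continuousAt_integral_snd (hK : IsCompact K) (hμ : ∀ᵐ z ∂μ, z ∈ K)
    (hU : IsOpen U) {f : Z × F → G} (hf : ∀ z ∈ K, ∀ x ∈ U, ContinuousAt f (z, x))
    {x : F} (hx : x ∈ U) : ContinuousAt (fun y => ∫ z, f (z, y) ∂μ) x := by
  have hint : ∀ y ∈ U, Integrable (fun z => f (z, y)) μ := fun y hy =>
    integrable_of_continuousOn_compact hK hμ fun z hz =>
      ((hf z hz y hy).comp (f := fun z => (z, y)) (by fun_prop)).continuousWithinAt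
  obtain ⟨r, hr, hrU⟩ := nhds_basis_closedBall.mem_iff.1 (hU.mem_nhds hx)
  obtain ⟨C, hC⟩ := (hK.prod (isCompact_closedBall x r)).exists_bound_of_continuousOn
    (f := f) fun q hq => (hf q.1 hq.1 q.2 (hrU hq.2)).continuousWithinAt
  refine continuousAt_of_dominated (bound := fun _ => C) ?_ ?_ (integrable_const C) ?_
  · filter_upwards [hU.mem_nhds hx] with y hy using (hint y hy).aestronglyMeasurable
  · filter_upwards [closedBall_mem_nhds x hr] with y hy
    filter_upwards [hμ] with z hz using hC (z, y) ⟨hz, hy⟩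
  · filter_upwards [hμ] with z hz
    exact (hf z hz x hx).comp (f := fun y => (z, y)) (by fun_prop)

theorem contDiffOn_integral_snd (hK : IsCompact K) (hμ : ∀ᵐ z ∂μ, z ∈ K)
    (hU : IsOpen U) {f : Z × F → G}
    (hf : ∀ z ∈ K, ∀ x ∈ U, ContDiffAt ℝ 2 f (z, x)) :
    ContDiffOn ℝ 2 (fun y => ∫ z, f (z, y) ∂μ) U := by
  have h1 : ∀ z ∈ K, ∀ x ∈ U, ContDiffAt ℝ 1 (fderivSnd f) (z, x) := fun z hz x hx =>
    contDiffAt_fderivSnd (k := 1) (by simpa [one_add_one_eq_two] using hf z hz x hx)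
  have d1 := fun x hx => hasFDerivAt_integral_snd (μ := μ) hK hμ hU
    (fun z hz x hx => (hf z hz x hx).of_le one_le_two) (x := x) hx
  have d2 := fun x hx => hasFDerivAt_integral_snd (μ := μ) hK hμ hU h1 (x := x) hx
  have c2 := fun x hx => continuousAt_integral_snd (μ := μ) hK hμ hU (fun z hz x hx =>
    (contDiffAt_fderivSnd (k := 0) (by simpa using h1 z hz x hx)).continuousAt) (x := x) hx
  rw [← one_add_one_eq_two, contDiffOn_succ_iff_fderiv_of_isOpen hU]
  refine ⟨fun x hx => (d1 x hx).differentiableAt.differentiableWithinAt, by simp, ?_⟩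
  refine ContDiffOn.congr ?_ fun x hx => (d1 x hx).fderiv
  rw [← zero_add (1 : WithTop ℕ∞), contDiffOn_succ_iff_fderiv_of_isOpen hU]
  refine ⟨fun x hx => (d2 x hx).differentiableAt.differentiableWithinAt, by simp, ?_⟩
  refine ContDiffOn.congr ?_ fun x hx => (d2 x hx).fderiv
  rw [contDiffOn_zero]
  exact fun x hx => (c2 x hx).continuousWithinAt

end ParametricIntegral

/-! ### The Laplacian of an integral. -/

theorem conf_contDiffAt {n : ℕ} {x : E n} (hx : ‖x‖ < 1) (k : WithTop ℕ∞) :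
    ContDiffAt ℝ k (conf : E n → ℝ) x := by
  have : (1 - ‖x‖ ^ 2) ≠ 0 := by nlinarith [norm_nonneg x]
  exact contDiffAt_const.div (contDiffAt_const.sub (contDiff_norm_sq ℝ).contDiffAt) this

theorem conf_pos {n : ℕ} {x : E n} (hx : ‖x‖ < 1) : 0 < conf x := by
  have : 0 < (1 - ‖x‖ ^ 2) := by nlinarith [norm_nonneg x]
  exact div_pos two_pos this

theorem partialDeriv_congr {n : ℕ} {i : Fin n} {f g : E n → ℝ} {x : E n} (h : f =ᶠ[𝓝 x] g) :
    partialDeriv i f x = partialDeriv i g x := by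
  rw [partialDeriv, partialDeriv, h.fderiv_eq]

theorem hypLaplacian_congr {n : ℕ} {f g : E n → ℝ} {x : E n} (h : f =ᶠ[𝓝 x] g) :
    hypLaplacian f x = hypLaplacian g x := by
  unfold hypLaplacian
  congr 1
  refine Finset.sum_congr rfl fun i _ => partialDeriv_congr ?_
  filter_upwards [h.eventuallyEq_nhds] with y hy
  rw [partialDeriv_congr hy]

/-- The Laplacian commutes with integration over a compact parameter set. -/
theorem hypLaplacian_integral {n : ℕ} {μ : Measure (E n)} [IsFiniteMeasure μ] {S : Set (E n)}
    (hS : IsCompact S) (hμ : ∀ᵐ z ∂μ, z ∈ S) {f : E n × E n → ℝ}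
    (hf : ∀ z ∈ S, ∀ x ∈ ball (0 : E n) 1, ContDiffAt ℝ 2 f (z, x))
    {x : E n} (hx : x ∈ ball (0 : E n) 1) :
    hypLaplacian (fun y => ∫ z, f (z, y) ∂μ) x = ∫ z, hypLaplacian (fun y => f (z, y)) x ∂μ := by
  have hf1 : ∀ z ∈ S, ∀ y ∈ ball (0 : E n) 1, ContDiffAt ℝ 1 (fderivSnd f) (z, y) :=
    fun z hz y hy => contDiffAt_fderivSnd (k := 1) (by simpa [one_add_one_eq_two] using hf z hz y hy)
  -- A single differentiation under the integral for any `C¹` integrand; it is used for `f` and then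
  -- for the flux `g i`, since the Laplacian is in divergence form.
  have pd : ∀ {g : E n × E n → ℝ} (_ : ∀ z ∈ S, ∀ y ∈ ball (0 : E n) 1, ContDiffAt ℝ 1 g (z, y))
      {y : E n} (_ : y ∈ ball (0 : E n) 1) (i : Fin n),
      Integrable (fun z => fderivSnd g (z, y) (EuclideanSpace.single i 1)) μ ∧
      partialDeriv i (fun y => ∫ z, g (z, y) ∂μ) y =
        ∫ z, fderivSnd g (z, y) (EuclideanSpace.single i 1) ∂μ := by
    intro g hg y hy i
    have hint : Integrable (fun z => fderivSnd g (z, y)) μ :=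
      integrable_of_continuousOn_compact hS hμ fun z hz =>
        ((contDiffAt_fderivSnd (k := 0) (by simpa using hg z hz y hy)).continuousAt.comp
          (f := fun z => (z, y)) (by fun_prop)).continuousWithinAt
    refine ⟨hint.apply_continuousLinearMap _, ?_⟩
    rw [partialDeriv, (hasFDerivAt_integral_snd hS hμ isOpen_ball hg hy).fderiv,
      ContinuousLinearMap.integral_apply hint]
  have pd1 : ∀ {g : E n × E n → ℝ} {z y : E n}, ContDiffAt ℝ 1 g (z, y) → ∀ (i : Fin n),
      partialDeriv i (fun y => g (z, y)) y =
        fderivSnd g (z, y) (EuclideanSpace.single i 1) := fun h i => by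
    rw [partialDeriv, (hasFDerivAt_fderivSnd (h.differentiableAt one_ne_zero)).fderiv]
  let g : Fin n → E n × E n → ℝ := fun i q =>
    conf q.2 ^ n * (conf q.2 ^ 2)⁻¹ * fderivSnd f q (EuclideanSpace.single i 1)
  have hg : ∀ i, ∀ z ∈ S, ∀ y ∈ ball (0 : E n) 1, ContDiffAt ℝ 1 (g i) (z, y) := by
    intro i z hz y hy
    have hy' : ‖y‖ < 1 := mem_ball_zero_iff.1 hy
    have hc : ContDiffAt ℝ 1 (fun q : E n × E n => conf q.2) (z, y) :=
      ContDiffAt.comp (g := conf) (z, y) (conf_contDiffAt hy' 1) contDiffAt_snd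
    exact ((hc.pow n).mul ((hc.pow 2).inv (pow_ne_zero _ (conf_pos hy').ne'))).mul
      ((hf1 z hz y hy).clm_apply contDiffAt_const)
  have hf' : ∀ z ∈ S, ∀ y ∈ ball (0 : E n) 1, ContDiffAt ℝ 1 f (z, y) :=
    fun z hz y hy => (hf z hz y hy).of_le one_le_two
  have hnb : ∀ᶠ y in 𝓝 x, y ∈ ball (0 : E n) 1 := isOpen_ball.mem_nhds hx
  unfold hypLaplacian
  rw [integral_const_mul]
  congr 1
  have e1 : ∀ᵐ z ∂μ, (∑ i : Fin n, partialDeriv i (fun y => conf y ^ n * (conf y ^ 2)⁻¹ *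
      partialDeriv i (fun y => f (z, y)) y) x) =
      ∑ i : Fin n, fderivSnd (g i) (z, x) (EuclideanSpace.single i 1) := by
    filter_upwards [hμ] with z hz
    refine Finset.sum_congr rfl fun i _ => ?_
    rw [← pd1 (hg i z hz x hx)]
    refine partialDeriv_congr ?_
    filter_upwards [hnb] with y hy
    simp only [g]
    rw [pd1 (hf' z hz y hy)]
  rw [integral_congr_ae e1, integral_finsetSum _ fun i _ => (pd (hg i) hx i).1]
  refine Finset.sum_congr rfl fun i _ => ?_
  rw [← (pd (hg i) hx i).2]
  refine partialDeriv_congr ?_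
  filter_upwards [hnb] with y hy
  simp only [g]
  rw [(pd hf' hy i).2, integral_const_mul]

/-! ### The eigenvalue equation for the horospherical functions. -/

theorem partialDeriv_eq {n : ℕ} {f : E n → ℝ} {f' : E n →L[ℝ] ℝ} {x : E n}
    (h : HasFDerivAt f f' x) (i : Fin n) :
    partialDeriv i f x = f' (EuclideanSpace.single i 1) := by
  rw [partialDeriv, h.fderiv]

section

variable {n : ℕ} {z y : E n}

theorem hasFDerivAt_one_sub_norm_sq (y : E n) :
    HasFDerivAt (fun y : E n => 1 - ‖y‖ ^ 2) ((-2 : ℝ) • innerSL ℝ y) y := by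
  refine ((hasStrictFDerivAt_norm_sq y).hasFDerivAt.const_sub 1).congr_fderiv ?_
  ext v; simp

theorem hasFDerivAt_norm_sub_sq (z y : E n) :
    HasFDerivAt (fun y : E n => ‖z - y‖ ^ 2) ((-2 : ℝ) • innerSL ℝ (z - y)) y := by
  refine (((hasFDerivAt_id y).const_sub z).norm_sq).congr_fderiv ?_
  ext v; simp; ring

theorem hasFDerivAt_conf (hy : ‖y‖ < 1) :
    HasFDerivAt (conf : E n → ℝ) ((conf y ^ 2) • innerSL ℝ y) y := by
  have h : 1 - ‖y‖ ^ 2 ≠ 0 := by nlinarith [norm_nonneg y]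
  refine ((hasDerivAt_inv h).comp_hasFDerivAt y (hasFDerivAt_one_sub_norm_sq y)
    |>.const_mul 2).congr_fderiv ?_
  ext v
  simp [conf]
  field_simp

/-- The logarithm of a multiple of the Poisson ratio, as a function on the ball. -/
def busemann (c : ℝ) (z y : E n) : ℝ :=
  Real.log c + Real.log (1 - ‖y‖ ^ 2) - Real.log (‖z - y‖ ^ 2)

theorem hasFDerivAt_busemann (c : ℝ) (hy : ‖y‖ < 1) (hzy : z ≠ y) :
    HasFDerivAt (busemann c z) ((-2 / (1 - ‖y‖ ^ 2)) • innerSL ℝ y +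
      (2 / ‖z - y‖ ^ 2) • innerSL ℝ (z - y)) y := by
  have h : 1 - ‖y‖ ^ 2 ≠ 0 := by nlinarith [norm_nonneg y]
  have h2 : ‖z - y‖ ^ 2 ≠ 0 := pow_ne_zero _ (norm_ne_zero_iff.2 (sub_ne_zero.2 hzy))
  refine ((((hasFDerivAt_one_sub_norm_sq y).log h).const_add (Real.log c)).sub
    ((hasFDerivAt_norm_sub_sq z y).log h2)).congr_fderiv ?_
  ext v
  simp
  ring

/-- With `|∇b| = 1` and `Δb = -2a`, the chain rule gives `Δ(e^{ab} b) = e^{ab} ((ab+1)(-2a) + a²b +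
2a) = -a² e^{ab} b`. The constant `c` absorbs a change of base point. -/
theorem hypLaplacian_exp_mul_busemann {z x : E n} (hn : 2 ≤ n) (c : ℝ) (hz : ‖z‖ = 1)
    (hx : ‖x‖ < 1) :
    -hypLaplacian (fun y => Real.exp (((n : ℝ) - 1) / 2 * busemann c z y) * busemann c z y) x =
      lambdaOne n * (Real.exp (((n : ℝ) - 1) / 2 * busemann c z x) * busemann c z x) := by
  -- With `n = m + 2` the weight `ρⁿ ρ⁻²` in the divergence is the honest power `ρ^m`.
  obtain ⟨m, rfl⟩ := Nat.exists_eq_add_of_le' hn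
  set a : ℝ := (((m + 2 : ℕ) : ℝ) - 1) / 2 with ha
  have hne : ∀ {y : E (m + 2)}, ‖y‖ < 1 → z ≠ y := by
    rintro y hy rfl; linarith
  let β : Fin (m + 2) → E (m + 2) → ℝ := fun i y =>
    -2 / (1 - ‖y‖ ^ 2) * y i + 2 / ‖z - y‖ ^ 2 * (z i - y i)
  have pu : ∀ y : E (m + 2), ‖y‖ < 1 → ∀ i, partialDeriv i
      (fun y => Real.exp (a * busemann c z y) * busemann c z y) y =
      Real.exp (a * busemann c z y) * (a * busemann c z y + 1) * β i y := by
    intro y hy i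
    have hb := hasFDerivAt_busemann c hy (hne hy)
    refine (partialDeriv_eq (f := fun y => Real.exp (a * busemann c z y) * busemann c z y)
      ((hb.const_mul a).exp.mul hb) i).trans ?_
    simp [β, EuclideanSpace.inner_single_right]
    ring
  have hβ : ∀ y : E (m + 2), ‖y‖ < 1 → ∀ i, ∃ β' : E (m + 2) →L[ℝ] ℝ, HasFDerivAt (β i) β' y ∧
      β' (EuclideanSpace.single i 1) = -2 / (1 - ‖y‖ ^ 2) - 4 / (1 - ‖y‖ ^ 2) ^ 2 * y i ^ 2
        - 2 / ‖z - y‖ ^ 2 + 4 / (‖z - y‖ ^ 2) ^ 2 * (z i - y i) ^ 2 := by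
    intro y hy i
    have h : 1 - ‖y‖ ^ 2 ≠ 0 := by nlinarith [norm_nonneg y]
    have h2 : ‖z - y‖ ^ 2 ≠ 0 := pow_ne_zero _ (norm_ne_zero_iff.2 (sub_ne_zero.2 (hne hy)))
    have hp : HasFDerivAt (fun y : E (m + 2) => y i) (EuclideanSpace.proj (𝕜 := ℝ) i) y :=
      (EuclideanSpace.proj (𝕜 := ℝ) i).hasFDerivAt
    have d1 := (((hasDerivAt_inv h).comp_hasFDerivAt y (hasFDerivAt_one_sub_norm_sq y)).const_mul
      (-2)).mul hp
    have d2 := (((hasDerivAt_inv h2).comp_hasFDerivAt y (hasFDerivAt_norm_sub_sq z y)).const_mul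
      2).mul (hp.const_sub (z i))
    refine ⟨_, d1.add d2, ?_⟩
    simp [EuclideanSpace.inner_single_right]
    generalize 1 - ‖y‖ ^ 2 = A at *
    generalize ‖z - y‖ ^ 2 = R at *
    field_simp
    ring
  have hA : 0 < 1 - ‖x‖ ^ 2 := by nlinarith [norm_nonneg x]
  have hR : 0 < ‖z - x‖ ^ 2 := pow_pos (norm_pos_iff.2 (sub_ne_zero.2 (hne hx))) 2
  have flux : ∀ i, partialDeriv i (fun y => conf y ^ (m + 2) * (conf y ^ 2)⁻¹ * partialDeriv i
      (fun y => Real.exp (a * busemann c z y) * busemann c z y) y) x =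
      Real.exp (a * busemann c z x) * conf x ^ m * (
        (a * busemann c z x + 1) * (m * conf x * x i * β i x + (-2 / (1 - ‖x‖ ^ 2)
          - 4 / (1 - ‖x‖ ^ 2) ^ 2 * x i ^ 2
          - 2 / ‖z - x‖ ^ 2 + 4 / (‖z - x‖ ^ 2) ^ 2 * (z i - x i) ^ 2)) +
        (a ^ 2 * busemann c z x + 2 * a) * β i x ^ 2) := by
    intro i
    have e : (fun y => conf y ^ (m + 2) * (conf y ^ 2)⁻¹ * partialDeriv i
      (fun y => Real.exp (a * busemann c z y) * busemann c z y) y) =ᶠ[𝓝 x]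
      fun y => conf y ^ m * (Real.exp (a * busemann c z y) * (a * busemann c z y + 1) * β i y) := by
      filter_upwards [isOpen_ball.mem_nhds (mem_ball_zero_iff.2 hx)] with y hy
      have hy := mem_ball_zero_iff.1 hy
      rw [pu y hy, pow_add, mul_inv_cancel_right₀ (pow_ne_zero _ (conf_pos hy).ne')]
    have hb := hasFDerivAt_busemann c hx (hne hx)
    obtain ⟨β', hβ', hβe⟩ := hβ x hx i
    -- The truncated exponent `m - 1` is harmless at `m = 0`, where the factor `m` vanishes.
    have hm : (m : ℝ) * conf x ^ (m - 1) * conf x ^ 2 = m * conf x ^ m * conf x := by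
      cases m with
      | zero => simp
      | succ k => simp; ring
    refine (partialDeriv_congr e).trans ((partialDeriv_eq (f := fun y => conf y ^ m *
      (Real.exp (a * busemann c z y) * (a * busemann c z y + 1) * β i y)) (((hasFDerivAt_conf hx).pow
      m).mul (((hb.const_mul a).exp.mul ((hb.const_mul a).add_const 1)).mul hβ')) i).trans ?_)
    simp [hβe, EuclideanSpace.inner_single_right]
    have hbe : -2 / (1 - ‖x‖ ^ 2) * x i + 2 / ‖z - x‖ ^ 2 * (z i - x i) = β i x := rfl
    linear_combination (conf x ^ m * β i x * Real.exp (a * busemann c z x) *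
      (a * (a * busemann c z x + 2))) * hbe + (Real.exp (a * busemann c z x) *
      (a * busemann c z x + 1) * β i x * x i) * hm
  have s1 : ∑ i, x i ^ 2 = ‖x‖ ^ 2 := (EuclideanSpace.real_norm_sq_eq x).symm
  have s2 : ∑ i, (z i - x i) ^ 2 = ‖z - x‖ ^ 2 := (EuclideanSpace.real_norm_sq_eq (z - x)).symm
  -- Polarization of `|z|² = 1`. Together with `s1` and `s2` it reduces the sum over `i` to an
  -- expression in `A` and `R` alone.
  have s3 : ∑ i, x i * (z i - x i) = ((1 - ‖x‖ ^ 2) - ‖z - x‖ ^ 2) / 2 := by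
    have h1 : ∑ i, z i ^ 2 = 1 := by rw [← EuclideanSpace.real_norm_sq_eq z, hz, one_pow]
    rw [← s1, ← s2, ← h1, ← Finset.sum_sub_distrib, ← Finset.sum_sub_distrib, Finset.sum_div]
    exact Finset.sum_congr rfl fun i _ => by ring
  rw [hypLaplacian, Finset.sum_congr rfl fun i _ => flux i, ← Finset.mul_sum]
  set b := busemann c z x
  set A := 1 - ‖x‖ ^ 2 with hAdef
  set R := ‖z - x‖ ^ 2
  have hc : conf x = 2 / A := rfl
  have key : ∑ i, ((a * b + 1) * (m * conf x * x i * β i x + (-2 / A - 4 / A ^ 2 * x i ^ 2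
          - 2 / R + 4 / R ^ 2 * (z i - x i) ^ 2)) + (a ^ 2 * b + 2 * a) * β i x ^ 2) =
      - a ^ 2 * b * (2 / A) ^ 2 := by
    have : ∀ i, ((a * b + 1) * (m * conf x * x i * β i x + (-2 / A - 4 / A ^ 2 * x i ^ 2
          - 2 / R + 4 / R ^ 2 * (z i - x i) ^ 2)) + (a ^ 2 * b + 2 * a) * β i x ^ 2) =
        ((a * b + 1) * (m * conf x * (-2 / A) - 4 / A ^ 2) +
          (a ^ 2 * b + 2 * a) * (4 / A ^ 2)) * x i ^ 2 +
        ((a * b + 1) * (m * conf x * (2 / R)) + (a ^ 2 * b + 2 * a) * (-8 / (A * R))) *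
          (x i * (z i - x i)) +
        ((a * b + 1) * (4 / R ^ 2) + (a ^ 2 * b + 2 * a) * (4 / R ^ 2)) * (z i - x i) ^ 2 +
        (a * b + 1) * (-2 / A - 2 / R) := by
      intro i
      have hbe : β i x = -2 / A * x i + 2 / R * (z i - x i) := rfl
      rw [hbe]
      field_simp
      ring
    rw [Finset.sum_congr rfl fun i _ => this i, Finset.sum_add_distrib, Finset.sum_add_distrib,
      Finset.sum_add_distrib, ← Finset.mul_sum, ← Finset.mul_sum, ← Finset.mul_sum, s1, s2, s3,
      Finset.sum_const, Finset.card_univ, Fintype.card_fin, nsmul_eq_mul, hc,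
      show ‖x‖ ^ 2 = 1 - A by rw [hAdef]; ring]
    have hm : (m : ℝ) = 2 * a - 1 := by rw [ha]; push_cast; ring
    push_cast
    rw [hm]
    field_simp
    ring
  rw [key, hc, lambdaOne, show (((m + 2 : ℕ) : ℝ) - 1) ^ 2 / 4 = a ^ 2 by rw [ha]; ring,
    pow_add]
  field_simp

end

/-! ### Potential estimates for measures with an upper density bound. -/

/-- On the shell `2^k δ ≤ dist z x < 2^(k+1) δ` the integrand is at most `(2^k δ)^(-t)` and the mass
at most `K (2^(k+1) δ)^s`; the products form a geometric series of ratio `2^(s-t) < 1`. `C` is fixed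
before the space and the measure, which is how `M₀` comes to depend only on `n`, `s` and `K`. -/
theorem lintegral_dist_rpow_neg_le {s t K : ℝ} (hst : s < t) (ht : 0 < t) (hK : 0 < K) :
    ∃ C : ℝ, 0 < C ∧ ∀ {Y : Type*} [PseudoMetricSpace Y] [MeasurableSpace Y]
      [OpensMeasurableSpace Y] (ν : Measure Y) (x : Y) (δ : ℝ), 0 < δ →
      (∀ r : ℝ, 0 < r → ν (ball x r) ≤ ENNReal.ofReal (K * r ^ s)) →
      (∀ᵐ z ∂ν, δ ≤ dist z x) →
      ∫⁻ z, ENNReal.ofReal (dist z x ^ (-t)) ∂ν ≤ ENNReal.ofReal (C * δ ^ (s - t)) := by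
  have hq0 : (0 : ℝ) < 2 ^ (s - t) := by positivity
  have hq1 : (2 : ℝ) ^ (s - t) < 1 :=
    Real.rpow_lt_one_of_one_lt_of_neg one_lt_two (by linarith)
  refine ⟨K * 2 ^ s * (1 - 2 ^ (s - t))⁻¹, by
    have : (0 : ℝ) < 1 - 2 ^ (s - t) := by linarith
    positivity, ?_⟩
  intro Y _ _ _ ν x δ hδ hν hd
  have hpt : ∀ᵐ z ∂ν, ENNReal.ofReal (dist z x ^ (-t)) ≤ ∑' k : ℕ,
      (ball x (2 ^ (k + 1) * δ)).indicator
        (fun _ => ENNReal.ofReal ((2 ^ k * δ) ^ (-t))) z := by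
    filter_upwards [hd] with z hz
    obtain ⟨k, hk1, hk2⟩ := exists_nat_pow_near ((one_le_div hδ).2 hz) one_lt_two
    rw [le_div_iff₀ hδ] at hk1
    rw [div_lt_iff₀ hδ] at hk2
    refine le_trans ?_ (ENNReal.le_tsum k)
    rw [indicator_of_mem (mem_ball.2 hk2)]
    exact ENNReal.ofReal_le_ofReal
      (Real.rpow_le_rpow_of_nonpos (by positivity) hk1 (by linarith))
  have hterm : ∀ k : ℕ, (2 ^ k * δ) ^ (-t) * (K * (2 ^ (k + 1) * δ) ^ s) =
      K * 2 ^ s * δ ^ (s - t) * (2 ^ (s - t)) ^ k := by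
    intro k
    have h2 : ((2 : ℝ) ^ (s - t)) ^ k = (2 ^ k) ^ s * (2 ^ k) ^ (-t) := by
      rw [← Real.rpow_add (by positivity), ← Real.rpow_natCast, ← Real.rpow_natCast,
        ← Real.rpow_mul two_pos.le, ← Real.rpow_mul two_pos.le, sub_eq_add_neg, mul_comm]
    rw [h2, sub_eq_add_neg, Real.rpow_add hδ, Real.mul_rpow (by positivity) hδ.le,
      Real.mul_rpow (by positivity) hδ.le, pow_succ, Real.mul_rpow (by positivity) two_pos.le]
    ring
  calc ∫⁻ z, ENNReal.ofReal (dist z x ^ (-t)) ∂ν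
      ≤ ∫⁻ z, ∑' k : ℕ, (ball x (2 ^ (k + 1) * δ)).indicator
        (fun _ => ENNReal.ofReal ((2 ^ k * δ) ^ (-t))) z ∂ν := lintegral_mono_ae hpt
    _ = ∑' k : ℕ, ENNReal.ofReal ((2 ^ k * δ) ^ (-t)) * ν (ball x (2 ^ (k + 1) * δ)) := by
      rw [lintegral_tsum fun k => (measurable_const.indicator measurableSet_ball).aemeasurable]
      exact tsum_congr fun k => lintegral_indicator_const measurableSet_ball _
    _ ≤ ∑' k : ℕ, ENNReal.ofReal (K * 2 ^ s * δ ^ (s - t) * (2 ^ (s - t)) ^ k) := by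
      refine ENNReal.tsum_le_tsum fun k => ?_
      rw [← hterm, ENNReal.ofReal_mul (by positivity)]
      gcongr
      exact hν _ (by positivity)
    _ = ENNReal.ofReal (K * 2 ^ s * (1 - 2 ^ (s - t))⁻¹ * δ ^ (s - t)) := by
      rw [← ENNReal.ofReal_tsum_of_nonneg (fun k => by positivity)
        ((summable_geometric_of_lt_one hq0.le hq1).mul_left _), tsum_mul_left,
        tsum_geometric_of_lt_one hq0.le hq1]
      congr 1
      ring

/-- The Poisson ratio `(1 - |x|²) / |z - x|²`. -/
def poissonRatio {n : ℕ} (z x : E n) : ℝ := (1 - ‖x‖ ^ 2) / ‖z - x‖ ^ 2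

section

variable {n : ℕ} {z x : E n}

theorem horoFun_eq (z x : E n) :
    horoFun z x = poissonRatio z x ^ (((n : ℝ) - 1) / 2) * Real.log (poissonRatio z x) := rfl

theorem one_sub_norm_le_norm_sub (hz : ‖z‖ = 1) : 1 - ‖x‖ ≤ ‖z - x‖ := by
  rw [← hz]; exact norm_sub_norm_le z x

theorem poissonRatio_pos (hz : ‖z‖ = 1) (hx : ‖x‖ < 1) : 0 < poissonRatio z x := by
  have h1 := one_sub_norm_le_norm_sub (x := x) hz
  have h2 : 0 < 1 - ‖x‖ ^ 2 := by nlinarith [norm_nonneg x]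
  have h3 : 0 < ‖z - x‖ := by linarith
  unfold poissonRatio
  positivity

theorem one_sub_norm_sq_le (hx : ‖x‖ < 1) : 1 - ‖x‖ ^ 2 ≤ 2 * (1 - ‖x‖) := by
  nlinarith [norm_nonneg x]

theorem one_sub_norm_le_sq (hx : ‖x‖ < 1) : 1 - ‖x‖ ≤ 1 - ‖x‖ ^ 2 := by
  nlinarith [norm_nonneg x]

theorem poissonRatio_le (hz : ‖z‖ = 1) (hx : ‖x‖ < 1) : poissonRatio z x ≤ 2 / (1 - ‖x‖) := by
  have h1 := one_sub_norm_le_norm_sub (x := x) hz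
  have h2 := one_sub_norm_sq_le hx
  have h0 : 0 < 1 - ‖x‖ := by linarith
  calc poissonRatio z x ≤ 2 * (1 - ‖x‖) / (1 - ‖x‖) ^ 2 := by unfold poissonRatio; gcongr
    _ = 2 / (1 - ‖x‖) := by field_simp

theorem le_poissonRatio {ρ : ℝ} (hz : ‖z‖ = 1) (hx : ‖x‖ < 1) (h : ‖z - x‖ ≤ ρ) :
    (1 - ‖x‖) / ρ ^ 2 ≤ poissonRatio z x := by
  have h1 := one_sub_norm_le_norm_sub (x := x) hz
  have h2 := one_sub_norm_le_sq hx
  have h0 : 0 < 1 - ‖x‖ := by linarith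
  have : 0 < ‖z - x‖ := by linarith
  have : 0 < ρ := by linarith
  unfold poissonRatio
  gcongr
  linarith

theorem continuousOn_poissonRatio (hx : ‖x‖ < 1) :
    ContinuousOn (fun z => poissonRatio z x) (sphere 0 1) := by
  unfold poissonRatio
  refine continuousOn_const.div (by fun_prop) fun z hz => ?_
  have h1 := one_sub_norm_le_norm_sub (x := x) (mem_sphere_zero_iff_norm.1 hz)
  exact pow_ne_zero _ (by linarith)

variable {ν : Measure (E n)} [IsFiniteMeasure ν]

theorem integrable_poissonRatio_rpow (hν : ∀ᵐ z ∂ν, z ∈ sphere (0 : E n) 1) (hx : ‖x‖ < 1)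
    (b : ℝ) : Integrable (fun z => poissonRatio z x ^ b) ν :=
  integrable_of_continuousOn_compact (isCompact_sphere _ _) hν
    ((continuousOn_poissonRatio hx).rpow_const fun _ hz =>
      Or.inl (poissonRatio_pos (mem_sphere_zero_iff_norm.1 hz) hx).ne')

theorem integrable_horoFun (hν : ∀ᵐ z ∂ν, z ∈ sphere (0 : E n) 1) (hx : ‖x‖ < 1) :
    Integrable (fun z => horoFun z x) ν :=
  integrable_of_continuousOn_compact (isCompact_sphere _ _) hν
    (((continuousOn_poissonRatio hx).rpow_const fun _ hz =>
      Or.inl (poissonRatio_pos (mem_sphere_zero_iff_norm.1 hz) hx).ne').mul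
      ((continuousOn_poissonRatio hx).log fun _ hz =>
        (poissonRatio_pos (mem_sphere_zero_iff_norm.1 hz) hx).ne'))

end

/-- Points of the sphere lie at distance at least `1 - ‖x‖` from `x`, and `P^b ≤ (2(1-‖x‖))^b
|z-x|^(-2b)`, so the shell estimate applies with `t = 2b` and `δ = 1 - ‖x‖`. -/
theorem integral_poissonRatio_rpow_le (n : ℕ) {s b K : ℝ} (hsb : s < 2 * b) (hb : 0 < b)
    (hK : 0 < K) :
    ∃ C : ℝ, 0 < C ∧ ∀ (ν : Measure (E n)) [IsFiniteMeasure ν],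
      (∀ᵐ z ∂ν, z ∈ sphere (0 : E n) 1) →
      (∀ x, ∀ r : ℝ, 0 < r → ν (ball x r) ≤ ENNReal.ofReal (K * r ^ s)) →
      ∀ x : E n, ‖x‖ < 1 → ∫ z, poissonRatio z x ^ b ∂ν ≤ C * (1 - ‖x‖) ^ (s - b) := by
  obtain ⟨C, hC, h⟩ := lintegral_dist_rpow_neg_le (K := K) hsb (by positivity) hK
  refine ⟨2 ^ b * C, by positivity, fun ν _ hS hν x hx => ?_⟩
  have hδ : 0 < 1 - ‖x‖ := by linarith
  have h1 := h ν x (1 - ‖x‖) hδ (hν x) (by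
    filter_upwards [hS] with z hz
    rw [dist_eq_norm]
    exact one_sub_norm_le_norm_sub (mem_sphere_zero_iff_norm.1 hz))
  rw [← ENNReal.ofReal_le_ofReal_iff (by positivity), ofReal_integral_eq_lintegral_ofReal
    (integrable_poissonRatio_rpow hS hx b)]
  · calc ∫⁻ z, ENNReal.ofReal (poissonRatio z x ^ b) ∂ν
        ≤ ∫⁻ z, ENNReal.ofReal ((2 * (1 - ‖x‖)) ^ b) *
            ENNReal.ofReal (dist z x ^ (-(2 * b))) ∂ν := by
          refine lintegral_mono_ae ?_
          filter_upwards [hS] with z hz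
          have hz := mem_sphere_zero_iff_norm.1 hz
          have h2 := one_sub_norm_le_norm_sub (x := x) hz
          have h3 : 0 < ‖z - x‖ := by linarith
          rw [← ENNReal.ofReal_mul (by positivity)]
          refine ENNReal.ofReal_le_ofReal ?_
          have e : ‖z - x‖ ^ (-(2 * b)) = ((‖z - x‖ ^ 2) ^ b)⁻¹ := by
            rw [Real.rpow_neg h3.le, Real.rpow_mul h3.le]; norm_cast
          rw [dist_eq_norm, e, ← div_eq_mul_inv, ← Real.div_rpow (by positivity) (by positivity)]
          refine Real.rpow_le_rpow (poissonRatio_pos hz hx).le ?_ hb.le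
          unfold poissonRatio
          gcongr
          exact one_sub_norm_sq_le hx
      _ ≤ ENNReal.ofReal ((2 * (1 - ‖x‖)) ^ b) *
            ENNReal.ofReal (C * (1 - ‖x‖) ^ (s - 2 * b)) := by
          rw [lintegral_const_mul' _ _ ENNReal.ofReal_ne_top]
          gcongr
      _ = ENNReal.ofReal (2 ^ b * C * (1 - ‖x‖) ^ (s - b)) := by
          rw [← ENNReal.ofReal_mul (by positivity), Real.mul_rpow two_pos.le hδ.le,
            show s - b = b + (s - 2 * b) by ring, Real.rpow_add hδ]
          congr 1
          ring
  · filter_upwards [hS] with z hz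
    exact Real.rpow_nonneg (poissonRatio_pos (mem_sphere_zero_iff_norm.1 hz) hx).le _

/-! ### Decay in terms of the hyperbolic distance. -/

theorem hdist_nonneg {n : ℕ} (x y : E n) : 0 ≤ hdist x y :=
  mul_nonneg two_pos.le (Real.arsinh_nonneg_iff.2 (by positivity))

theorem exp_hdist_zero {n : ℕ} {x : E n} (hx : ‖x‖ < 1) :
    Real.exp (hdist x 0) = (1 + ‖x‖) / (1 - ‖x‖) := by
  have h0 : 0 < 1 - ‖x‖ := by linarith
  have h1 : 0 < 1 + ‖x‖ := by linarith [norm_nonneg x]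
  have e1 : (1 - ‖x‖ ^ 2) = (1 + ‖x‖) * (1 - ‖x‖) := by ring
  have h2 : 0 < 1 - ‖x‖ ^ 2 := by rw [e1]; positivity
  have h3 : 0 < √(1 - ‖x‖ ^ 2) := Real.sqrt_pos.2 h2
  have h4 : √(1 - ‖x‖ ^ 2) ^ 2 = 1 - ‖x‖ ^ 2 := Real.sq_sqrt h2.le
  have e2 : Real.exp (Real.arsinh (‖x‖ / √(1 - ‖x‖ ^ 2))) = (1 + ‖x‖) / √(1 - ‖x‖ ^ 2) := by
    rw [Real.exp_arsinh, div_pow, h4, show 1 + ‖x‖ ^ 2 / (1 - ‖x‖ ^ 2) = 1 / (1 - ‖x‖ ^ 2) by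
      field_simp; ring, Real.sqrt_div zero_le_one, Real.sqrt_one]
    ring
  have : hdist x 0 = Real.arsinh (‖x‖ / √(1 - ‖x‖ ^ 2)) + Real.arsinh (‖x‖ / √(1 - ‖x‖ ^ 2)) := by
    simp [hdist, two_mul]
  rw [this, Real.exp_add, e2, div_mul_div_comm, ← sq √_, h4, e1]
  field_simp

/-- `(1-‖x‖)/4 ≤ P ≤ 2/(1-‖x‖)`, while `e^d ≥ 1/(1-‖x‖)`; the summand `2` pays for the factor `4 ≤
e²`. -/
theorem abs_log_poissonRatio_le {n : ℕ} {z x : E n} (hz : ‖z‖ = 1) (hx : ‖x‖ < 1) :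
    |Real.log (poissonRatio z x)| ≤ hdist x 0 + 2 := by
  have h0 : 0 < 1 - ‖x‖ := by linarith
  have hP := poissonRatio_pos hz hx
  have he : (4 : ℝ) ≤ Real.exp 2 := by
    have := Real.add_one_le_exp (1 : ℝ)
    rw [show (2 : ℝ) = 1 + 1 by norm_num, Real.exp_add]
    nlinarith
  have hE : 4 / (1 - ‖x‖) ≤ Real.exp (hdist x 0 + 2) := by
    rw [Real.exp_add, exp_hdist_zero hx, div_mul_eq_mul_div]
    gcongr
    nlinarith [norm_nonneg x]
  rw [abs_le]
  constructor
  · rw [Real.le_log_iff_exp_le hP, Real.exp_neg]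
    have h1 := le_poissonRatio (ρ := 2) hz hx
      ((norm_sub_le z x).trans (by linarith))
    refine le_trans ?_ h1
    refine (inv_anti₀ (by positivity) hE).trans (le_of_eq ?_)
    rw [inv_div]; norm_num
  · rw [Real.log_le_iff_le_exp hP]
    refine (poissonRatio_le hz hx).trans (le_trans ?_ hE)
    gcongr
    norm_num

theorem abs_integral_horoFun_le (n : ℕ) {s K : ℝ} (hs₁ : ((n : ℝ) - 1) / 2 < s)
    (hs₂ : s < (n : ℝ) - 1) (hK : 0 < K) :
    ∃ M : ℝ, 0 < M ∧ ∀ (ν : Measure (E n)) [IsFiniteMeasure ν],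
      (∀ᵐ z ∂ν, z ∈ sphere (0 : E n) 1) →
      (∀ x, ∀ r : ℝ, 0 < r → ν (ball x r) ≤ ENNReal.ofReal (K * r ^ s)) →
      ∀ x : E n, ‖x‖ < 1 → |∫ z, horoFun z x ∂ν| ≤
        M * (hdist x 0 + 1) * Real.exp (-((s - ((n : ℝ) - 1) / 2) * hdist x 0)) := by
  have ha : 0 < ((n : ℝ) - 1) / 2 := by linarith
  set a : ℝ := ((n : ℝ) - 1) / 2
  obtain ⟨C, hC, h⟩ := integral_poissonRatio_rpow_le n (s := s) (b := a) (K := K)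
    (by simp only [a]; linarith) ha hK
  -- The first `2` comes from `d + 2 ≤ 2(d + 1)`, the power from `1 - ‖x‖ ≤ 2e^{-d}`.
  refine ⟨2 * C * 2 ^ (s - a), by positivity, fun ν _ hS hν x hx => ?_⟩
  have hd := hdist_nonneg x 0
  have hδ : 0 < 1 - ‖x‖ := by linarith
  have hδ2 : 1 - ‖x‖ ≤ 2 * Real.exp (-hdist x 0) := by
    have : 0 < 1 + ‖x‖ := by linarith [norm_nonneg x]
    rw [Real.exp_neg, exp_hdist_zero hx, inv_div, ← mul_div_assoc, le_div_iff₀ this]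
    nlinarith
  calc |∫ z, horoFun z x ∂ν| ≤ ∫ z, |horoFun z x| ∂ν := abs_integral_le_integral_abs
    _ ≤ ∫ z, (hdist x 0 + 2) * poissonRatio z x ^ a ∂ν := by
      refine integral_mono_ae (integrable_horoFun hS hx).abs
        ((integrable_poissonRatio_rpow hS hx a).const_mul _) ?_
      filter_upwards [hS] with z hz
      have hz := mem_sphere_zero_iff_norm.1 hz
      have hp : 0 ≤ poissonRatio z x ^ a := Real.rpow_nonneg (poissonRatio_pos hz hx).le _
      rw [horoFun_eq, abs_mul, abs_of_nonneg hp, mul_comm]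
      gcongr
      exact abs_log_poissonRatio_le hz hx
    _ ≤ (hdist x 0 + 2) * (C * (1 - ‖x‖) ^ (s - a)) := by
      rw [integral_const_mul]
      gcongr
      exact h ν hS hν x hx
    _ ≤ (2 * (hdist x 0 + 1)) * (C * (2 * Real.exp (-hdist x 0)) ^ (s - a)) := by
      gcongr
      linarith
    _ = _ := by
      rw [Real.mul_rpow two_pos.le (Real.exp_pos _).le, ← Real.exp_mul,
        show -hdist x 0 * (s - a) = -((s - a) * hdist x 0) by ring]
      ring

/-! ### Positivity near points of positive lower density. -/

theorem eventually_integral_horoFun_pos {n : ℕ} {s K : ℝ} (hs₁ : ((n : ℝ) - 1) / 2 < s)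
    (hs₂ : s < (n : ℝ) - 1) (hK : 0 < K) (ν : Measure (E n)) [IsFiniteMeasure ν]
    (hS : ∀ᵐ z ∂ν, z ∈ sphere (0 : E n) 1)
    (hν : ∀ x, ∀ r : ℝ, 0 < r → ν (ball x r) ≤ ENNReal.ofReal (K * r ^ s))
    {p : E n} {c C : ℝ} (hc : 0 < c) (hC : 0 ≤ C)
    (hp : ∀ᶠ r in 𝓝[>] (0 : ℝ), c * r ^ s ≤ ν.real (ball p r)) :
    ∀ᶠ δ in 𝓝[>] (0 : ℝ), ∀ x : E n, 1 - ‖x‖ = δ → ‖x - p‖ ≤ C * δ →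
      0 < ∫ z, horoFun z x ∂ν := by
  set a : ℝ := ((n : ℝ) - 1) / 2 with ha
  -- Small enough that `s < 2(a - ε)`, so the potential estimate still holds with exponent `a - ε`.
  set ε : ℝ := (2 * a - s) / 4 with hε
  have hs0 : s < 2 * a := by rw [ha]; linarith
  have ha0 : 0 < a := by linarith
  have hε0 : 0 < ε := by rw [hε]; linarith
  obtain ⟨M, hM, h⟩ := integral_poissonRatio_rpow_le n (s := s) (b := a - ε) (K := K)
    (by linarith) (by linarith) hK
  -- For `z ∈ B_δ(p)` one has `|z - x| ≤ (C+1)δ`, hence `P ≥ δ/((C+1)δ)² = k/δ`. The condition `t1`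
  -- then forces `log P ≥ 1` there, and `t2` makes the error smaller than the main term.
  set k : ℝ := 1 / (C + 1) ^ 2 with hk
  have hk0 : 0 < k := by positivity
  have t1 : ∀ᶠ δ in 𝓝[>] (0 : ℝ), δ < k / Real.exp 1 :=
    (eventually_lt_nhds (by positivity)).filter_mono nhdsWithin_le_nhds
  have t2 : ∀ᶠ δ in 𝓝[>] (0 : ℝ), M / ε * δ ^ ε < k ^ a * c := by
    have : Tendsto (fun δ : ℝ => M / ε * δ ^ ε) (𝓝 0) (𝓝 (M / ε * 0 ^ ε)) :=
      ((Real.continuousAt_rpow_const 0 ε (Or.inr hε0.le)).tendsto).const_mul _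
    rw [Real.zero_rpow hε0.ne', mul_zero] at this
    exact (this.eventually (eventually_lt_nhds (by positivity))).filter_mono nhdsWithin_le_nhds
  filter_upwards [hp, t1, t2, self_mem_nhdsWithin] with δ hp t1 t2 hδ x hxδ hxp
  have hδ : 0 < δ := hδ
  have hx : ‖x‖ < 1 := by linarith
  have hke : Real.exp 1 ≤ k / δ := by
    rw [lt_div_iff₀ (Real.exp_pos 1)] at t1
    rw [le_div_iff₀ hδ]; linarith
  have hlow : ∀ᵐ z ∂ν, (ball p δ).indicator (fun _ => (k / δ) ^ a) z
      - ε⁻¹ * poissonRatio z x ^ (a - ε) ≤ horoFun z x := by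
    filter_upwards [hS] with z hz
    have hz := mem_sphere_zero_iff_norm.1 hz
    have hP := poissonRatio_pos hz hx
    have hPε : 0 ≤ ε⁻¹ * poissonRatio z x ^ (a - ε) := by positivity
    rw [horoFun_eq]
    by_cases hzp : z ∈ ball p δ
    · rw [indicator_of_mem hzp]
      have hzx : ‖z - x‖ ≤ (C + 1) * δ := by
        calc ‖z - x‖ ≤ ‖z - p‖ + ‖p - x‖ := norm_sub_le_norm_sub_add_norm_sub z p x
          _ ≤ δ + C * δ := add_le_add (mem_ball_iff_norm.1 hzp).le (by rwa [norm_sub_rev])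
          _ = (C + 1) * δ := by ring
      have h1 : k / δ ≤ poissonRatio z x := by
        refine le_trans (le_of_eq ?_) (le_poissonRatio hz hx hzx)
        rw [hxδ, hk]; field_simp
      have h2 : 1 ≤ Real.log (poissonRatio z x) := by
        rw [Real.le_log_iff_exp_le hP]; linarith
      have h3 : (k / δ) ^ a ≤ poissonRatio z x ^ a := by gcongr
      have h4 : 0 ≤ (k / δ) ^ a := by positivity
      nlinarith
    -- Away from the ball, `log P ≥ -ε⁻¹ P^(-ε)`, which is `log y ≤ y^ε/ε` at `y = 1/P`.
    · rw [indicator_of_notMem hzp]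
      have h1 := Real.log_le_rpow_div (inv_nonneg.2 hP.le) hε0
      rw [Real.log_inv, Real.inv_rpow hP.le] at h1
      have h2 : poissonRatio z x ^ (a - ε) = poissonRatio z x ^ a * (poissonRatio z x ^ ε)⁻¹ := by
        rw [Real.rpow_sub hP, div_eq_mul_inv]
      have h3 : 0 ≤ poissonRatio z x ^ a := by positivity
      rw [h2]
      have := mul_le_mul_of_nonneg_left h1 h3
      rw [div_eq_mul_inv] at this
      linarith
  have hi1 : Integrable ((ball p δ).indicator fun _ => (k / δ) ^ a) ν :=
    (integrable_const _).indicator measurableSet_ball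
  have hi2 := (integrable_poissonRatio_rpow hS hx (a - ε)).const_mul ε⁻¹
  have hmono := integral_mono_ae (hi1.sub hi2) (integrable_horoFun hS hx) hlow
  have hsub := integral_sub hi1 hi2
  rw [integral_indicator_const _ measurableSet_ball, integral_const_mul, smul_eq_mul] at hsub
  have hup := h ν hS hν x hx
  rw [hxδ] at hup
  have hup' := mul_le_mul_of_nonneg_left hup (inv_nonneg.2 hε0.le)
  have hlo := mul_le_mul_of_nonneg_right hp (show 0 ≤ (k / δ) ^ a by positivity)
  have e1 : c * δ ^ s * (k / δ) ^ a = δ ^ (s - a) * (k ^ a * c) := by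
    rw [Real.div_rpow hk0.le hδ.le, Real.rpow_sub hδ]; ring
  have e2 : ε⁻¹ * (M * δ ^ (s - (a - ε))) = δ ^ (s - a) * (M / ε * δ ^ ε) := by
    rw [show s - (a - ε) = s - a + ε by ring, Real.rpow_add hδ]; ring
  have hfin := mul_lt_mul_of_pos_left t2 (Real.rpow_pos_of_pos hδ (s - a))
  have hmono' := hsub.symm.le.trans hmono
  linarith

/-! ### Change of base point. -/

section

variable {n : ℕ} {o : E n}

theorem contDiffAt_translate {x : E n} (ho : ‖o‖ < 1) (hx : ‖x‖ ≤ 1) (k : WithTop ℕ∞) :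
    ContDiffAt ℝ k (translate o) x := by
  have h := (denom_pos ho hx).ne'
  have h1 : ContDiff ℝ k fun x : E n => (inner ℝ o x : ℝ) := contDiff_const.inner ℝ contDiff_id
  have h2 : ContDiff ℝ k fun x : E n => ‖x‖ ^ 2 := contDiff_norm_sq ℝ
  have h3 : ContDiff ℝ k fun x : E n => 1 - 2 * inner ℝ o x + ‖o‖ ^ 2 * ‖x‖ ^ 2 :=
    (contDiff_const.sub (contDiff_const.mul h1)).add (contDiff_const.mul h2)
  have h4 : ContDiff ℝ k fun x : E n => 1 - 2 * inner ℝ o x + ‖x‖ ^ 2 :=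
    (contDiff_const.sub (contDiff_const.mul h1)).add h2
  have h5 : ContDiff ℝ k fun x : E n => (1 - ‖o‖ ^ 2) • x := contDiff_id.const_smul _
  have h6 : ContDiff ℝ k fun x : E n => (1 - 2 * inner ℝ o x + ‖x‖ ^ 2) • o :=
    h4.smul contDiff_const
  exact (h3.contDiffAt.inv h).smul (h5.sub h6).contDiffAt

theorem translate_self (o : E n) : translate o o = 0 := by
  rw [translate, real_inner_self_eq_norm_sq,
    show 1 - 2 * ‖o‖ ^ 2 + ‖o‖ ^ 2 = 1 - ‖o‖ ^ 2 by ring, sub_self, smul_zero]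

theorem norm_translate_eq_one {ξ : E n} (ho : ‖o‖ < 1) (hξ : ‖ξ‖ = 1) : ‖translate o ξ‖ = 1 :=
  (exists_geodesicRay_identification ho hξ).1

theorem contDiffAt_horoFun {z x : E n} (hz : ‖z‖ = 1) (hx : ‖x‖ < 1) (k : WithTop ℕ∞) :
    ContDiffAt ℝ k (fun q : E n × E n => horoFun q.1 q.2) (z, x) := by
  have h1 := one_sub_norm_le_norm_sub (x := x) hz
  have hP := (poissonRatio_pos hz hx).ne'
  have h2 : ContDiffAt ℝ k (fun q : E n × E n => poissonRatio q.1 q.2) (z, x) := by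
    refine ContDiffAt.div ?_ ?_ (pow_ne_zero 2 (by simp only; linarith))
    · exact (contDiff_const.sub (contDiff_snd.norm_sq ℝ)).contDiffAt
    · exact ((contDiff_fst.sub contDiff_snd).norm_sq ℝ).contDiffAt
  exact (h2.rpow_const_of_ne hP).mul (h2.log hP)

theorem contDiffAt_horoFun_translate {z x : E n} (ho : ‖o‖ < 1) (hz : ‖z‖ = 1) (hx : ‖x‖ < 1)
    (k : WithTop ℕ∞) :
    ContDiffAt ℝ k (fun q : E n × E n => horoFun q.1 (translate o q.2)) (z, x) := by
  have h : ContDiffAt ℝ k (fun q : E n × E n => (q.1, translate o q.2)) (z, x) :=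
    contDiffAt_fst.prodMk
      (ContDiffAt.comp (g := translate o) (f := Prod.snd) (z, x)
        (contDiffAt_translate ho hx.le k) contDiffAt_snd)
  exact ContDiffAt.comp (g := fun q : E n × E n => horoFun q.1 q.2)
    (f := fun q : E n × E n => (q.1, translate o q.2)) (z, x)
    (contDiffAt_horoFun hz (translate_norm_lt_one ho hx) k) h

/-- The translation is conformal, and the conformal factor at `x` cancels between numerator and
denominator. Only a factor depending on `ξ` survives. -/
theorem poissonRatio_translate {ξ x : E n} (ho : ‖o‖ < 1) (hξ : ‖ξ‖ = 1) (hx : ‖x‖ < 1) :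
    poissonRatio (translate o ξ) (translate o x) =
      (1 - 2 * inner ℝ o ξ + ‖o‖ ^ 2 * ‖ξ‖ ^ 2) / (1 - ‖o‖ ^ 2) * poissonRatio ξ x := by
  have h1 := one_sub_norm_le_norm_sub (x := x) hξ
  have h2 : ‖ξ - x‖ ≠ 0 := by linarith
  have h3 : 1 - ‖o‖ ^ 2 ≠ 0 := by nlinarith [norm_nonneg o]
  have h4 := (denom_pos ho hξ.le).ne'
  have h5 := (denom_pos ho hx.le).ne'
  rw [poissonRatio, poissonRatio, translate_norm_sq ho hx.le, translate_sub_norm_sq ho hξ.le hx.le]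
  generalize 1 - 2 * inner ℝ o ξ + ‖o‖ ^ 2 * ‖ξ‖ ^ 2 = D at *
  generalize 1 - 2 * inner ℝ o x + ‖o‖ ^ 2 * ‖x‖ ^ 2 = D' at *
  generalize 1 - ‖o‖ ^ 2 = A at *
  generalize 1 - ‖x‖ ^ 2 = B at *
  field_simp

theorem horoFun_translate {ξ x : E n} (ho : ‖o‖ < 1) (hξ : ‖ξ‖ = 1) (hx : ‖x‖ < 1) :
    horoFun (translate o ξ) (translate o x) = Real.exp (((n : ℝ) - 1) / 2 * busemann
      ((1 - 2 * inner ℝ o ξ + ‖o‖ ^ 2 * ‖ξ‖ ^ 2) / (1 - ‖o‖ ^ 2)) ξ x) * busemann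
      ((1 - 2 * inner ℝ o ξ + ‖o‖ ^ 2 * ‖ξ‖ ^ 2) / (1 - ‖o‖ ^ 2)) ξ x := by
  have h1 := one_sub_norm_le_norm_sub (x := x) hξ
  have h2 : ‖ξ - x‖ ^ 2 ≠ 0 := pow_ne_zero 2 (by linarith)
  have h3 : 0 < 1 - ‖o‖ ^ 2 := by nlinarith [norm_nonneg o]
  have h4 := denom_pos ho hξ.le
  have h5 : 1 - ‖x‖ ^ 2 ≠ 0 := by nlinarith [norm_nonneg x]
  have hP := poissonRatio_pos (norm_translate_eq_one ho hξ) (translate_norm_lt_one ho hx)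
  have e : Real.log (poissonRatio (translate o ξ) (translate o x)) = busemann
      ((1 - 2 * inner ℝ o ξ + ‖o‖ ^ 2 * ‖ξ‖ ^ 2) / (1 - ‖o‖ ^ 2)) ξ x := by
    rw [poissonRatio_translate ho hξ hx, Real.log_mul (div_pos h4 h3).ne'
      (poissonRatio_pos hξ hx).ne', poissonRatio, Real.log_div h5 h2, busemann, add_sub_assoc]
  rw [horoFun_eq, Real.rpow_def_of_pos hP, e, mul_comm (busemann _ _ _)]

/-- Writing `z = translate o ξ` turns the function into `e^{ab} b` in the original coordinates, with
a constant depending on `ξ`. The invariance of the Laplacian under isometries is thus not needed. -/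
theorem neg_hypLaplacian_horoFun_translate {z x : E n} (hn : 2 ≤ n) (ho : ‖o‖ < 1)
    (hz : ‖z‖ = 1) (hx : ‖x‖ < 1) :
    -hypLaplacian (fun y => horoFun z (translate o y)) x =
      lambdaOne n * horoFun z (translate o x) := by
  have hno : ‖-o‖ < 1 := by rwa [norm_neg]
  obtain ⟨ξ, hξ, rfl⟩ : ∃ ξ : E n, ‖ξ‖ = 1 ∧ translate o ξ = z := by
    refine ⟨translate (-o) z, norm_translate_eq_one hno hz, ?_⟩
    simpa using translate_neg_translate hno hz
  rw [horoFun_translate ho hξ hx, ← hypLaplacian_exp_mul_busemann hn _ hξ hx]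
  congr 1
  refine hypLaplacian_congr ?_
  filter_upwards [isOpen_ball.mem_nhds (mem_ball_zero_iff.2 hx)] with y hy
  exact horoFun_translate ho hξ (mem_ball_zero_iff.1 hy)

/-- Along the Euclidean radius to `ξ`, the translated points approach `translate o ξ`
nontangentially. -/
theorem norm_translate_smul_sub_le {ξ : E n} (ho : ‖o‖ < 1) (hξ : ‖ξ‖ = 1) {t : ℝ} (ht0 : 0 < t)
    (ht1 : t < 1) :
    ‖translate o ((1 - t) • ξ) - translate o ξ‖ ≤
      4 / √(1 - 2 * inner ℝ o ξ + ‖o‖ ^ 2 * ‖ξ‖ ^ 2) * (1 - ‖translate o ((1 - t) • ξ)‖) := by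
  have hp : ‖(1 - t) • ξ‖ = 1 - t := by
    rw [norm_smul, hξ, mul_one, Real.norm_eq_abs, abs_of_pos (by linarith)]
  have hp1 : ‖(1 - t) • ξ‖ < 1 := by rw [hp]; linarith
  have hx := translate_norm_lt_one ho hp1
  have hD := denom_pos ho hξ.le
  have hD' := denom_pos ho hp1.le
  have hA : 0 < 1 - ‖o‖ ^ 2 := by nlinarith [norm_nonneg o]
  have h1 := one_sub_norm_sq_le hx
  have hD4 : 1 - 2 * inner ℝ o ((1 - t) • ξ) + ‖o‖ ^ 2 * ‖(1 - t) • ξ‖ ^ 2 ≤ 4 := by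
    have h2 := neg_le_of_abs_le (abs_real_inner_le_norm o ((1 - t) • ξ))
    have h3 : ‖o‖ * ‖(1 - t) • ξ‖ ≤ 1 := mul_le_one₀ ho.le (norm_nonneg _) hp1.le
    have h4 : 0 ≤ ‖o‖ * ‖(1 - t) • ξ‖ := by positivity
    nlinarith
  have hsub : ‖(1 - t) • ξ - ξ‖ ^ 2 = t ^ 2 := by
    rw [show (1 - t) • ξ - ξ = (-t) • ξ by module, norm_smul, hξ, mul_one, norm_neg,
      Real.norm_eq_abs, sq_abs]
  have e1 := translate_sub_norm_sq ho hp1.le hξ.le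
  have e2 := translate_norm_sq ho hp1.le
  rw [hsub] at e1
  rw [hp] at e2
  have hδ : 0 < 1 - ‖translate o ((1 - t) • ξ)‖ := by linarith
  refine le_of_sq_le_sq ?_ (by positivity)
  rw [mul_pow, div_pow, Real.sq_sqrt hD.le, e1]
  generalize 1 - 2 * inner ℝ o ξ + ‖o‖ ^ 2 * ‖ξ‖ ^ 2 = D at *
  rw [hp] at hD' hD4 ⊢
  generalize 1 - 2 * inner ℝ o ((1 - t) • ξ) + ‖o‖ ^ 2 * (1 - t) ^ 2 = D' at *
  generalize 1 - ‖translate o ((1 - t) • ξ)‖ = δ at *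
  generalize 1 - ‖o‖ ^ 2 = A at *
  -- `1 - (1-t)² ≥ t` and `1 - ‖y‖² ≤ 2(1 - ‖y‖)` for the translated point `y`. With `D' ≤ 4` this
  -- yields the constant `4/√D`.
  have h5 : A * t / D' ≤ 2 * δ := by
    refine le_trans ?_ h1
    rw [e2]
    gcongr
    nlinarith
  have h6 : (A * t / D') ^ 2 ≤ (2 * δ) ^ 2 := by gcongr
  calc A ^ 2 * t ^ 2 / (D' * D) = D' / D * (A * t / D') ^ 2 := by field_simp
    _ ≤ 4 / D * (2 * δ) ^ 2 := by gcongr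
    _ = 4 ^ 2 / D * δ ^ 2 := by ring

theorem tendsto_one_sub_norm_translate_smul {ξ : E n} (ho : ‖o‖ < 1) (hξ : ‖ξ‖ = 1) :
    Tendsto (fun t : ℝ => 1 - ‖translate o ((1 - t) • ξ)‖) (𝓝[>] 0) (𝓝[>] 0) := by
  refine tendsto_nhdsWithin_iff.2 ⟨?_, ?_⟩
  · have h1 : ContinuousAt (fun t : ℝ => (1 - t) • ξ) 0 := by fun_prop
    have h2 : ContinuousAt (translate o) ((1 - (0 : ℝ)) • ξ) := by
      rw [sub_zero, one_smul]
      exact (contDiffAt_translate ho hξ.le 0).continuousAt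
    have h3 := ((ContinuousAt.comp (g := translate o) (f := fun t : ℝ => (1 - t) • ξ)
      h2 h1).tendsto.norm.const_sub 1).mono_left (nhdsWithin_le_nhds (s := Ioi 0))
    simpa [norm_translate_eq_one ho hξ] using h3
  · filter_upwards [Ioo_mem_nhdsGT (zero_lt_one (α := ℝ))] with t ht
    have : ‖(1 - t) • ξ‖ < 1 := by
      rw [norm_smul, hξ, mul_one, Real.norm_eq_abs, abs_of_pos (by linarith [ht.2])]
      linarith [ht.1]
    exact sub_pos.2 (translate_norm_lt_one ho this)

end

/-! ### The restricted Hausdorff measure and the region `Ω`. -/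

/-- Measurability is required of `S` only, because `f_o(X)` need not be measurable. -/
theorem ae_restrict_mem_of_subset {Y : Type*} [MeasurableSpace Y] {μ : Measure Y} {T S : Set Y}
    (hS : MeasurableSet S) (h : T ⊆ S) : ∀ᵐ z ∂μ.restrict T, z ∈ S :=
  ae_mono (Measure.restrict_mono_set μ h) (ae_restrict_mem hS)

/-- The potential estimate centres balls at interior points `x`, while the hypothesis concerns
centres in `T`. A ball meeting `T` lies in one of twice the radius centred in `T`, at the cost of
`2^s`. -/
theorem restrict_ball_le {Y : Type*} [PseudoMetricSpace Y] [MeasurableSpace Y]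
    [OpensMeasurableSpace Y] {μ : Measure Y} {T : Set Y} {K s : ℝ}
    (h : ∀ p ∈ T, ∀ r : ℝ, 0 < r → μ (T ∩ ball p r) ≤ ENNReal.ofReal (K * r ^ s))
    (x : Y) {r : ℝ} (hr : 0 < r) :
    μ.restrict T (ball x r) ≤ ENNReal.ofReal (K * 2 ^ s * r ^ s) := by
  rw [Measure.restrict_apply measurableSet_ball]
  obtain he | ⟨p, hp, hpT⟩ := (ball x r ∩ T).eq_empty_or_nonempty
  · simp [he]
  · have hsub : ball x r ∩ T ⊆ T ∩ ball p (2 * r) := by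
      rintro y ⟨hy, hyT⟩
      refine ⟨hyT, mem_ball.2 ?_⟩
      have := dist_triangle_right y p x
      rw [mem_ball] at hy hp
      linarith
    refine (measure_mono hsub).trans ((h p hpT (2 * r) (by positivity)).trans ?_)
    rw [Real.mul_rpow two_pos.le hr.le, mul_assoc]

theorem exists_eventually_le_measureReal_ball {Y : Type*} [PseudoMetricSpace Y]
    [MeasurableSpace Y] [OpensMeasurableSpace Y] {μ : Measure Y} {T : Set Y}
    [IsFiniteMeasure (μ.restrict T)] {s : ℝ} {p : Y}
    (h : 0 < liminf (fun r : ℝ => μ (T ∩ ball p r) / ENNReal.ofReal (r ^ s)) (𝓝[>] 0)) :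
    ∃ c : ℝ, 0 < c ∧ ∀ᶠ r in 𝓝[>] (0 : ℝ), c * r ^ s ≤ (μ.restrict T).real (ball p r) := by
  obtain ⟨c, -, hc0, hc⟩ := ENNReal.lt_iff_exists_real_btwn.1 h
  refine ⟨c, ENNReal.ofReal_pos.1 hc0, ?_⟩
  filter_upwards [eventually_lt_of_lt_liminf hc, self_mem_nhdsWithin] with r hr hr0
  have hrs : 0 < r ^ s := Real.rpow_pos_of_pos hr0 s
  have h1 := (ENNReal.le_div_iff_mul_le (Or.inl (ENNReal.ofReal_pos.2 hrs).ne')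
    (Or.inl ENNReal.ofReal_ne_top)).1 hr.le
  rw [← ENNReal.ofReal_mul (ENNReal.ofReal_pos.1 hc0).le, inter_comm,
    ← Measure.restrict_apply measurableSet_ball] at h1
  exact (ENNReal.ofReal_le_iff_le_toReal (measure_ne_top _ _)).1 h1

/-- A set of points where `u` is positive and which is confined to nontangential regions at the
points of `X`. -/
def positiveRegion {n : ℕ} (u : E n → ℝ) (X : Set (E n)) : Set (E n) :=
  {p | p ∈ ball (0 : E n) 1 ∧ 0 < u p ∧ ∃ ξ ∈ X, dist p ξ < 2 * (1 - ‖p‖)}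

theorem isOpen_positiveRegion {n : ℕ} {u : E n → ℝ} {X : Set (E n)}
    (hu : ContinuousOn u (ball 0 1)) : IsOpen (positiveRegion u X) := by
  have h1 : IsOpen (ball (0 : E n) 1 ∩ u ⁻¹' Ioi 0) :=
    hu.isOpen_inter_preimage isOpen_ball isOpen_Ioi
  have h2 : IsOpen (⋃ ξ ∈ X, {p : E n | dist p ξ < 2 * (1 - ‖p‖)}) :=
    isOpen_biUnion fun ξ _ => isOpen_lt (by fun_prop) (by fun_prop)
  convert h1.inter h2 using 1
  ext p
  simp [positiveRegion, and_assoc]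

theorem asymptoticBoundary_positiveRegion {n : ℕ} {u : E n → ℝ} {X : Set (E n)}
    (hu : ContinuousOn u (ball 0 1)) (hX : X ⊆ sphere 0 1)
    (hpos : ∀ ξ ∈ X, ∀ᶠ t in 𝓝[>] (0 : ℝ), 0 < u ((1 - t) • ξ)) :
    asymptoticBoundary (positiveRegion u X) = closure X := by
  have hsub : positiveRegion u X ⊆ ball 0 1 := fun p hp => hp.1
  have hfr : asymptoticBoundary (positiveRegion u X) =
      closure (positiveRegion u X) ∩ sphere 0 1 := by
    rw [asymptoticBoundary, (isOpen_positiveRegion hu).frontier_eq]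
    ext p
    simp only [mem_inter_iff, Set.mem_sdiff]
    refine ⟨fun h => ⟨h.1.1, h.2⟩, fun h => ⟨⟨h.1, fun hp => ?_⟩, h.2⟩⟩
    have h1 := mem_ball_zero_iff.1 (hsub hp)
    have h2 := mem_sphere_zero_iff_norm.1 h.2
    linarith
  rw [hfr]
  apply Subset.antisymm
  · rintro p ⟨hp, hps⟩
    rw [Metric.mem_closure_iff] at hp ⊢
    intro ε hε
    -- Since `1 - ‖q‖ ≤ dist p q`, the point `ξ` satisfies `dist p ξ < 3 dist p q`, so `ε / 4`
    -- suffices.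
    obtain ⟨q, ⟨hq, -, ξ, hξ, hqξ⟩, hpq⟩ := hp (ε / 4) (by positivity)
    refine ⟨ξ, hξ, ?_⟩
    have h1 : 1 - ‖q‖ ≤ dist p q := by
      rw [← mem_sphere_zero_iff_norm.1 hps, dist_eq_norm]
      exact norm_sub_norm_le p q
    have := dist_triangle p q ξ
    linarith
  · refine subset_inter (closure_minimal ?_ isClosed_closure)
      (closure_minimal hX isClosed_sphere)
    intro ξ hξ
    have hξ1 := mem_sphere_zero_iff_norm.1 (hX hξ)
    have hlim : Tendsto (fun t : ℝ => (1 - t) • ξ) (𝓝[>] 0) (𝓝 ξ) := by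
      have : ContinuousAt (fun t : ℝ => (1 - t) • ξ) 0 := by fun_prop
      simpa using this.tendsto.mono_left (nhdsWithin_le_nhds (s := Ioi 0))
    refine mem_closure_of_tendsto hlim ?_
    filter_upwards [hpos ξ hξ, Ioo_mem_nhdsGT (zero_lt_one (α := ℝ))] with t ht ht1
    have hn : ‖(1 - t) • ξ‖ = 1 - t := by
      rw [norm_smul, hξ1, mul_one, Real.norm_eq_abs, abs_of_pos (by linarith [ht1.2])]
    -- The radial point at depth `t` is at distance `t` from `ξ`; the aperture `2` leaves room for
    -- the strict inequality.
    refine ⟨mem_ball_zero_iff.2 (by rw [hn]; linarith [ht1.1]), ht, ξ, hξ, ?_⟩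
    rw [hn, dist_eq_norm, show (1 - t) • ξ - ξ = (-t) • ξ by module, norm_smul, hξ1, norm_neg,
      Real.norm_eq_abs, abs_of_pos ht1.1]
    linarith [ht1.1]

theorem two_le_of_exists_between {n : ℕ} {s : ℝ} (hs₁ : ((n : ℝ) - 1) / 2 < s)
    (hs₂ : s < (n : ℝ) - 1) : 2 ≤ n := by
  have : (1 : ℝ) < n := by linarith
  exact_mod_cast this

theorem IsTrulyDimAt.nonempty {n : ℕ} {s K : ℝ} {o : E n} {X : Set (E n)} (hs : 0 < s)
    (h : IsTrulyDimAt s o K X) : X.Nonempty := by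
  by_contra hX
  have := h.dim_eq
  rw [not_nonempty_iff_eq_empty.1 hX, image_empty, dimH_empty] at this
  exact (ENNReal.ofReal_pos.2 hs).ne this

end HypBall

end

/-! ### Assembly of the theorem. -/

theorem mainTheorem3 (n : ℕ) (s : ℝ) (hs₁ : ((n : ℝ) - 1) / 2 < s) (hs₂ : s < (n : ℝ) - 1)
    (K : ℝ) (hK : 0 < K) :
    ∃ M₀ : ℝ, 0 < M₀ ∧
      ∀ (o : HypBall.E n) (_ : o ∈ Metric.ball (0 : HypBall.E n) 1)
        (X : Set (HypBall.E n)) (_ : X ⊆ Metric.sphere (0 : HypBall.E n) 1)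
        (_ : HypBall.IsTrulyDimAt s o K X),
        ∃ u : HypBall.E n → ℝ,
          HypBall.IsLambdaHarmonic (HypBall.lambdaOne n) u ∧
          (∃ C : ℝ, ∀ p ∈ Metric.ball (0 : HypBall.E n) 1, |u p| ≤ C) ∧
          (∃ Ω : Set (HypBall.E n), IsOpen Ω ∧ Ω ⊆ Metric.ball (0 : HypBall.E n) 1 ∧
            (∀ p ∈ Ω, 0 < u p) ∧ HypBall.asymptoticBoundary Ω = closure X) ∧
          (∀ p ∈ Metric.ball (0 : HypBall.E n) 1,
            |u p| ≤ M₀ * (HypBall.hdist p o + 1) *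
              Real.exp (-((s - ((n : ℝ) - 1) / 2) * HypBall.hdist p o))) ∧
          (∀ p ∈ Metric.ball (0 : HypBall.E n) 1,
            MeasureTheory.IntegrableOn
              (fun z => HypBall.horoFun z (HypBall.translate o p))
              (HypBall.identification o '' X) μH[s] ∧
            u p = ∫ z in HypBall.identification o '' X,
              HypBall.horoFun z (HypBall.translate o p) ∂μH[s]) := by
  have hn := HypBall.two_le_of_exists_between hs₁ hs₂
  have hs0 : 0 < s := by linarith
  obtain ⟨M, hM, hbound⟩ := HypBall.abs_integral_horoFun_le n hs₁ hs₂
    (K := K * 2 ^ s) (by positivity)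
  refine ⟨M, hM, fun o ho X hX hdim => ?_⟩
  have ho := mem_ball_zero_iff.1 ho
  set T := HypBall.identification o '' X with hT
  set ν : Measure (HypBall.E n) := (μH[s]).restrict T with hνdef
  have : IsFiniteMeasure ν := ⟨by
    rw [hνdef, Measure.restrict_apply_univ]; exact hdim.measure_lt_top⟩
  have hTS : T ⊆ sphere 0 1 := by
    rintro _ ⟨ξ, hξ, rfl⟩
    exact mem_sphere_zero_iff_norm.2
      (HypBall.norm_translate_eq_one ho (mem_sphere_zero_iff_norm.1 (hX hξ)))
  -- The whole sphere serves as the compact parameter set, since `T` itself need not be closed.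
  have hS : ∀ᵐ z ∂ν, z ∈ sphere (0 : HypBall.E n) 1 :=
    HypBall.ae_restrict_mem_of_subset isClosed_sphere.measurableSet hTS
  have hν : ∀ x, ∀ r : ℝ, 0 < r → ν (ball x r) ≤ ENNReal.ofReal (K * 2 ^ s * r ^ s) :=
    fun x r hr => HypBall.restrict_ball_le hdim.upper_density x hr
  have htr : ∀ {p : HypBall.E n}, p ∈ ball (0 : HypBall.E n) 1 → ‖HypBall.translate o p‖ < 1 :=
    fun hp => HypBall.translate_norm_lt_one ho (mem_ball_zero_iff.1 hp)
  have hdist : ∀ {p : HypBall.E n}, p ∈ ball (0 : HypBall.E n) 1 →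
      HypBall.hdist (HypBall.translate o p) 0 = HypBall.hdist p o := fun hp => by
    rw [← HypBall.translate_self o, HypBall.hdist_translate ho (mem_ball_zero_iff.1 hp) ho]
  let u : HypBall.E n → ℝ := fun p => ∫ z, HypBall.horoFun z (HypBall.translate o p) ∂ν
  have hdecay : ∀ p ∈ ball (0 : HypBall.E n) 1, |u p| ≤ M * (HypBall.hdist p o + 1) *
      Real.exp (-((s - ((n : ℝ) - 1) / 2) * HypBall.hdist p o)) := fun p hp => by
    rw [← hdist hp]
    exact hbound ν hS hν _ (htr hp)
  have hsm : ∀ z ∈ sphere (0 : HypBall.E n) 1, ∀ x ∈ ball (0 : HypBall.E n) 1,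
      ContDiffAt ℝ 2 (fun q : HypBall.E n × HypBall.E n =>
        HypBall.horoFun q.1 (HypBall.translate o q.2)) (z, x) := fun z hz x hx =>
    HypBall.contDiffAt_horoFun_translate ho (mem_sphere_zero_iff_norm.1 hz)
      (mem_ball_zero_iff.1 hx) 2
  have hC2 : ContDiffOn ℝ 2 u (ball 0 1) :=
    HypBall.contDiffOn_integral_snd (isCompact_sphere _ _) hS isOpen_ball hsm
  have hpos : ∀ ξ ∈ X, ∀ᶠ t in 𝓝[>] (0 : ℝ), 0 < u ((1 - t) • ξ) := by
    intro ξ hξ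
    have hξ1 := mem_sphere_zero_iff_norm.1 (hX hξ)
    obtain ⟨c, hc, hball⟩ := HypBall.exists_eventually_le_measureReal_ball
      (hdim.lower_density _ ⟨ξ, hξ, rfl⟩)
    have hev := HypBall.eventually_integral_horoFun_pos hs₁ hs₂ (by positivity) ν hS hν hc
      (C := 4 / √(1 - 2 * inner ℝ o ξ + ‖o‖ ^ 2 * ‖ξ‖ ^ 2)) (by positivity) hball
    filter_upwards [(HypBall.tendsto_one_sub_norm_translate_smul ho hξ1).eventually hev,
      Ioo_mem_nhdsGT (zero_lt_one (α := ℝ))] with t ht ht1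
    exact ht _ rfl (HypBall.norm_translate_smul_sub_le ho hξ1 ht1.1 ht1.2)
  refine ⟨u, ⟨hC2, ?_, fun x hx => ?_⟩, ?_, ⟨HypBall.positiveRegion u X,
    HypBall.isOpen_positiveRegion hC2.continuousOn, fun p hp => hp.1, fun p hp => hp.2.1,
    HypBall.asymptoticBoundary_positiveRegion hC2.continuousOn hX hpos⟩, hdecay,
    fun p hp => ⟨HypBall.integrable_horoFun hS (htr hp), rfl⟩⟩
  · obtain ⟨ξ, hξ⟩ := hdim.nonempty hs0
    obtain ⟨t, ht, ht1⟩ := ((hpos ξ hξ).and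
      (Ioo_mem_nhdsGT (zero_lt_one (α := ℝ)))).exists
    refine ⟨(1 - t) • ξ, mem_ball_zero_iff.2 ?_, ht.ne'⟩
    rw [norm_smul, mem_sphere_zero_iff_norm.1 (hX hξ), mul_one, Real.norm_eq_abs,
      abs_of_pos (by linarith [ht1.2])]
    linarith [ht1.1]
  · have h := HypBall.hypLaplacian_integral (isCompact_sphere _ _) hS hsm hx
    simp only at h
    rw [h, ← integral_neg, ← integral_const_mul]
    refine integral_congr_ae ?_
    filter_upwards [hS] with z hz
    exact HypBall.neg_hypLaplacian_horoFun_translate hn ho (mem_sphere_zero_iff_norm.1 hz)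
      (mem_ball_zero_iff.1 hx)
  · set κ := s - ((n : ℝ) - 1) / 2
    have hκ : 0 < κ := sub_pos.2 hs₁
    -- From `κd + 1 ≤ e^{κd}` one gets `d + 1 ≤ (1/κ + 1) e^{κd}`, so the linear factor is absorbed.
    refine ⟨M * (1 / κ + 1), fun p hp => (hdecay p hp).trans ?_⟩
    have hd := HypBall.hdist_nonneg p o
    generalize HypBall.hdist p o = d at hd
    have h1 := Real.add_one_le_exp (κ * d)
    have h2 : d + 1 ≤ (1 / κ + 1) * Real.exp (κ * d) := by
      have h3 : d ≤ 1 / κ * Real.exp (κ * d) := by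
        rw [one_div_mul_eq_div, le_div_iff₀ hκ]; linarith
      have h4 : 0 ≤ κ * d := by positivity
      linarith
    rw [mul_assoc, Real.exp_neg, ← div_eq_mul_inv]
    gcongr
    rwa [div_le_iff₀ (Real.exp_pos _)]
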